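/- Let $\mathscr A$ be a unital $C^*$-algebra with a pointwise norm-continuous action $\alpha$ of $\mathbb R^n$ by $*$-automorphisms, let $B$ be a skew-symmetric real $n\times n$ matrix, and let $\psi$ be an $\alpha$-invariant continuous trace on $\mathscr A$. Let $\mathscr A^\infty$ be the Fréchet space of all $a\in\mathscr A$ for which $t\mapsto\alpha_t(a)$ is smooth, with semi-norms $\|\delta^\gamma a\|$, $\delta^\gamma a=i^{-|\gamma|}\partial_t^\gamma|_{t=0}\alpha_t(a)$. Write $\langle\xi\rangle=(1+|\xi|^2)^{1/2}$. For $m\in\mathbb R$, $\mathrm S^m(\mathbb R^n,\mathscr A^\infty)$ is the space of smooth $f:\mathbb R^n\to\mathscr A^\infty$ with $\|\delta^\gamma\partial_\xi^\beta f(\xi)\|\le C_{\gamma\beta}\langle\xi\rangle^{m-|\beta|}$ for all $\gamma,\beta$. For $f\in \mathrm S^m(\mathbb R^n,\mathscr A^\infty)$ the multiplier $P_f$ acts on $u\in\mathscr S(\mathbb R^n,\mathscr A^\infty)$ by $$(P_fu)(x)=(2\pi)^{-n}\int_{\mathbb R^n} e^{i\langle x,\xi\rangle}\alpha_{-x}(f(\xi+Bx))\,\hat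 u(\xi)\,d\xi ,\qquad \hat u(\xi)=\int_{\mathbb R^n} e^{-i\langle x,\xi\rangle}u(x)\,dx,$$ and, if $m<-n$, $\mathrm{Tr}_\psi(P_f):=\psi(f^\vee(0))=(2\pi)^{-n}\int_{\mathbb R^n}\psi(f(\xi))\,d\xi$, where $f^\vee$ is the inverse Fourier transform of $f$. Let $\Gamma=\{re^{i\theta}:r>0,\ \theta_1<\theta<\theta_2\}$ with $0<\theta_2-\theta_1\le 2\pi$ be an open sector, and let $\log\mu=\log r+i\theta$ and $\mu^s=e^{s\log\mu}$ ($s\in\mathbb R$) be formed with $\theta\in(\theta_1,\theta_2)$. For $m,d\in\mathbb R$, $\mathrm S^{m,d}(\mathbb R^n\times\Gamma,\mathscr A^\infty)$ is the space of smooth $f:\mathbb R^n\times\Gamma\to\mathscr A^\infty$, holomorphic in $\mu\in\Gamma$, such that for all $j\ge0$ and $1/z\in\Gamma$ one has $\partial_z^j(z^df(\cdot,1/z))\in \mathrm S^{m+j}(\mathbb R^n,\mathscr A^\infty)$, with uniform symbol estimates for $|z|\le1$ and $1/z$ in any closed subsector of $\Gamma$ (here $z^d=(1/z)^{-d}$).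 Let $m,d\in\mathbb R$ and let $f\in \mathrm S^{m-d,d}(\mathbb R^n\times\Gamma,\mathscr A^\infty)$ be weakly polyhomogeneous, $f\sim\sum_{j\ge0}f_{m-j}$; that is, $f_{m-j}\in \mathrm S^{m-j-d,d}(\mathbb R^n\times\Gamma,\mathscr A^\infty)$, $f_{m-j}(t\xi,t\mu)=t^{m-j}f_{m-j}(\xi,\mu)$ for $|\xi|\ge1$, $\mu\in\Gamma$, $t\ge1$, and $f-\sum_{j<N}f_{m-j}\in \mathrm S^{m-d-N,d}(\mathbb R^n\times\Gamma,\mathscr A^\infty)$ for all $N\ge 0$. Assume that there are $m'<-n$ and $d'\in\mathbb R$ such that $f$ and all $f_{m-j}$ with $m-j-d\ge-n$ lie in $\mathrm S^{m',d'}(\mathbb R^n\times\Gamma,\mathscr A^\infty)$. Then for every $\mu\in\Gamma$ the symbol $f(\cdot,\mu)$ has order $<-n$, so that $\mathrm{Tr}_\psi(P_{f(\cdot,\mu)})=(2\pi)^{-n}\int\psi(f(\xi,\mu))\,d\xi$ is defined with a convergent integral, and there are complex numbers $c_j,c_k',c_k''$ $(j,k\ge0)$ such that $$\mathrm{Tr}_\psi(P_{f(\cdot,\mu)})\sim\sum_{j=0}^\infty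 c_j\mu^{m-j+n}+\sum_{k=0}^\infty(c_k'\log\mu+c_k'')\mu^{-k+d}$$ as $\mu\to\infty$ in closed subsectors of $\Gamma$; that is, for every closed subsector $\Gamma'$ of $\Gamma$ and all $J,K\ge0$ there is $C$ such that, for all $\mu\in\Gamma'$ with $|\mu|\ge1$, $$\Big|\mathrm{Tr}_\psi(P_{f(\cdot,\mu)})-\sum_{j<J}c_j\mu^{m-j+n}-\sum_{k<K}(c_k'\log\mu+c_k'')\mu^{-k+d}\Big|\le C\big(|\mu|^{m-J+n}+(1+\log|\mu|)|\mu|^{d-K}\big).$$ -/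

import Mathlib

open scoped ContDiff InnerProductSpace

noncomputable section

namespace WeaklyParametric

/-- Euclidean space `ℝⁿ`. -/
abbrev E (n : ℕ) : Type := EuclideanSpace ℝ (Fin n)

/-- The length `|γ|` of a multi-index. -/
def mlen {n : ℕ} (γ : Fin n → ℕ) : ℕ := ∑ i, γ i

/-- The iterated partial derivative `∂^γ g (x)`: the derivative of order `|γ|` of `g`, evaluated on
the list of basis vectors in which `e_i` occurs `γ i` times. -/
def pderiv {n : ℕ} {F : Type*} [NormedAddCommGroup F] [NormedSpace ℝ F]
    (γ : Fin n → ℕ) (g : E n → F) (x : E n) : F :=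
  iteratedFDeriv ℝ (∑ i, γ i) g x
    (fun k => EuclideanSpace.single (finSigmaFinEquiv.symm k).1 (1 : ℝ))

/-- The Japanese bracket `⟨ξ⟩ = (1 + |ξ|²)^{1/2}`. -/
def jb {n : ℕ} (ξ : E n) : ℝ := Real.sqrt (1 + ‖ξ‖ ^ 2)

/-! ### Twisted `C*`-dynamical systems -/

/-- A twisted `C*`-dynamical system `(A, ℝⁿ, α, e)`: a pointwise norm-continuous action `α` of `ℝⁿ`
on the unital `C*`-algebra `A` by `*`-automorphisms, and the cocycle `e(x,y) = exp(i⟨Bx, y⟩)`,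
recorded through the skew-symmetric real matrix `B`. -/
structure TwistedSystem (n : ℕ) (A : Type*) [CStarAlgebra A] where
  act : E n → (A ≃⋆ₐ[ℂ] A)
  act_zero : ∀ a, act 0 a = a
  act_add : ∀ s t a, act (s + t) a = act s (act t a)
  act_continuous : ∀ a, Continuous fun t => act t a
  B : Matrix (Fin n) (Fin n) ℝ
  skew : B.transpose = -B

namespace TwistedSystem

variable {n : ℕ} {A : Type*} [CStarAlgebra A] (S : TwistedSystem n A)

/-- Membership in the smooth subalgebra `A^∞`. -/
def IsSmooth (a : A) : Prop := ContDiff ℝ ∞ fun t => S.act t a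

/-- `δ^γ a = i^{-|γ|} ∂_t^γ|_{t=0} α_t(a)`. -/
def delta (γ : Fin n → ℕ) (a : A) : A :=
  (Complex.I⁻¹ ^ mlen γ) • pderiv γ (fun t => S.act t a) 0

/-- Smoothness on an open set `U` of a map with values in the Fréchet space `A^∞`. The maps `δ^γ`
embed `A^∞` as a closed subspace of the product of copies of `A` indexed by `γ`, so a map into
`A^∞` is smooth exactly if all its components `δ^γ ∘ g` are. -/
def SmoothOn {V : Type*} [NormedAddCommGroup V] [NormedSpace ℝ V] (g : V → A) (U : Set V) : Prop :=
  (∀ x ∈ U, S.IsSmooth (g x)) ∧ ∀ γ : Fin n → ℕ, ContDiffOn ℝ ∞ (fun x => S.delta γ (g x)) U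

/-- The symbol space `S^m(ℝⁿ, A^∞)`. -/
def IsSymbol (m : ℝ) (f : E n → A) : Prop :=
  S.SmoothOn f Set.univ ∧
    ∀ a b : Fin n → ℕ, ∃ C : ℝ, ∀ ξ : E n, ‖S.delta a (pderiv b f ξ)‖ ≤ C * jb ξ ^ (m - mlen b)

/-! ### Pseudodifferential multipliers and the trace -/

/-- The Schwartz space `𝒮(ℝⁿ, A^∞)`: all the maps `δ^γ ∘ u` are `A`-valued Schwartz maps. -/
def SchwartzSmooth : Type _ :=
  {u : SchwartzMap (E n) A // (∀ x, S.IsSmooth (u x)) ∧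
    ∀ γ : Fin n → ℕ, ∃ v : SchwartzMap (E n) A, ∀ x, v x = S.delta γ (u x)}

/-- The Fourier transform `û(ξ) = ∫ e^{-i⟨x,ξ⟩} u(x) dx`. -/
def fourier (u : E n → A) (ξ : E n) : A :=
  ∫ x : E n, Complex.exp (-(Complex.I * (⟪x, ξ⟫_ℝ : ℝ))) • u x

/-- The inverse Fourier transform `g^∨(x) = (2π)^{-n} ∫ e^{i⟨ξ,x⟩} g(ξ) dξ`. -/
def invFourier (g : E n → A) (x : E n) : A :=
  ((2 * Real.pi : ℝ) ^ n)⁻¹ • ∫ ξ : E n, Complex.exp (Complex.I * (⟪ξ, x⟫_ℝ : ℝ)) • g ξ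

/-- The vector `Bx`. -/
def applyB (x : E n) : E n := WithLp.toLp 2 (S.B.mulVec x.ofLp)

/-- The pseudodifferential multiplier `P_f = M_{f^∨}` on `𝒮(ℝⁿ, A^∞)`:
`(P_f u)(x) = (2π)^{-n} ∫ e^{i⟨x,ξ⟩} α_{-x}(f(ξ + Bx)) û(ξ) dξ`. -/
def multiplier (f : E n → A) (u : S.SchwartzSmooth) (x : E n) : A :=
  ((2 * Real.pi : ℝ) ^ n)⁻¹ •
    ∫ ξ : E n, Complex.exp (Complex.I * (⟪x, ξ⟫_ℝ : ℝ)) •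
      (S.act (-x) (f (ξ + S.applyB x)) * fourier u.1 ξ)

/-- `P` is a pseudodifferential multiplier `P_f` with symbol `f` of order `< -n`. -/
def HasTraceSymbol (P : S.SchwartzSmooth → E n → A) (f : E n → A) : Prop :=
  (∃ m : ℝ, m < -(n : ℝ) ∧ S.IsSymbol m f) ∧ S.multiplier f = P

open Classical in
/-- The trace `Tr_ψ(P_f) = ψ(f^∨(0))` on the pseudodifferential multipliers of order `< -n`
(and `0` on all other operators). The symbol is determined by the operator. -/
def Tr (ψ : A →L[ℂ] ℂ) (P : S.SchwartzSmooth → E n → A) : ℂ :=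
  if h : ∃ f, S.HasTraceSymbol P f then ψ (invFourier h.choose 0) else 0

end TwistedSystem

/-- `ψ` is an `α`-invariant continuous trace. -/
def IsInvariantTrace {n : ℕ} {A : Type*} [CStarAlgebra A] (S : TwistedSystem n A)
    (ψ : A →L[ℂ] ℂ) : Prop :=
  (∀ a b, ψ (a * b) = ψ (b * a)) ∧ ∀ t a, ψ (S.act t a) = ψ a

/-! ### Sectors -/

/-- An open sector `{r e^{iθ} : r > 0, lo < θ < hi}` in `ℂ ∖ {0}`. -/
structure Sector where
  lo : ℝ
  hi : ℝ
  lo_lt_hi : lo < hi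
  width_le : hi - lo ≤ 2 * Real.pi

namespace Sector

/-- The open sector as a set. -/
def carrier (Γ : Sector) : Set ℂ :=
  {μ | ∃ r > 0, ∃ θ ∈ Set.Ioo Γ.lo Γ.hi, μ = (r : ℝ) * Complex.exp ((θ : ℝ) * Complex.I)}

/-- The closed sector `{r e^{iθ} : r > 0, a ≤ θ ≤ b}`; it is a closed subsector of `Γ` if
`Γ.lo < a` and `b < Γ.hi`. -/
def closedSector (a b : ℝ) : Set ℂ :=
  {μ | ∃ r > 0, ∃ θ ∈ Set.Icc a b, μ = (r : ℝ) * Complex.exp ((θ : ℝ) * Complex.I)}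

/-- The branch of the logarithm on `Γ` with imaginary part in `(lo, hi)`. -/
def log (Γ : Sector) (μ : ℂ) : ℂ :=
  Complex.log (μ * Complex.exp (-(((Γ.lo + Γ.hi) / 2 : ℝ) * Complex.I))) +
    ((Γ.lo + Γ.hi) / 2 : ℝ) * Complex.I

/-- The power `μ^s`, for real `s`, formed with the branch `Γ.log`. -/
def pow (Γ : Sector) (μ : ℂ) (s : ℝ) : ℂ := Complex.exp (s * Γ.log μ)

theorem log_polar (Γ : Sector) {r θ : ℝ} (hr : 0 < r) (hθ : θ ∈ Set.Ioo Γ.lo Γ.hi) :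
    Γ.log (r * Complex.exp (θ * Complex.I)) = Real.log r + θ * Complex.I := by
  have hw := Γ.width_le
  obtain ⟨h1, h2⟩ := hθ
  have h : (r * Complex.exp (θ * Complex.I)) *
      Complex.exp (-(((Γ.lo + Γ.hi) / 2 : ℝ) * Complex.I)) =
      Complex.exp ((Real.log r : ℝ) + ((θ - (Γ.lo + Γ.hi) / 2 : ℝ) : ℂ) * Complex.I) := by
    rw [Complex.exp_add, ← Complex.ofReal_exp, Real.exp_log hr, mul_assoc, ← Complex.exp_add]
    push_cast
    ring_nf
  unfold Sector.log
  rw [h, Complex.log_exp]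
  · push_cast
    ring
  · simp
    linarith
  · simp
    linarith

end Sector

/-! ### Weakly parametric symbols -/

variable {n : ℕ} {A : Type*} [CStarAlgebra A]

/-- `∂_z^j (z^d f(ξ, 1/z))`, the power being `z^d = (1/z)^{-d}` for the branch on `Γ ∋ 1/z`. -/
def zDeriv (Γ : Sector) (d : ℝ) (f : E n → ℂ → A) (j : ℕ) (z : ℂ) (ξ : E n) : A :=
  iteratedDeriv j (fun w : ℂ => Γ.pow w⁻¹ (-d) • f ξ w⁻¹) z

/-- The space `S^{m,d}(ℝⁿ × Γ, A^∞)` of weakly parametric symbols. -/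
structure IsWeakSymbol (S : TwistedSystem n A) (Γ : Sector) (m d : ℝ) (f : E n → ℂ → A) :
    Prop where
  smooth : S.SmoothOn (fun p : E n × ℂ => f p.1 p.2) (Set.univ ×ˢ Γ.carrier)
  /-- holomorphic in `μ`, as a map into `A^∞` -/
  holomorphic : ∀ (ξ : E n) (γ : Fin n → ℕ),
    DifferentiableOn ℂ (fun μ => S.delta γ (f ξ μ)) Γ.carrier
  symbol : ∀ (j : ℕ) (z : ℂ), z⁻¹ ∈ Γ.carrier → S.IsSymbol (m + j) (zDeriv Γ d f j z)
  uniform : ∀ (j : ℕ) (a b : ℝ), Γ.lo < a → b < Γ.hi → ∀ γ β : Fin n → ℕ, ∃ C : ℝ,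
    ∀ (z : ℂ), z⁻¹ ∈ Sector.closedSector a b → ‖z‖ ≤ 1 → ∀ ξ : E n,
      ‖S.delta γ (pderiv β (zDeriv Γ d f j z) ξ)‖ ≤ C * jb ξ ^ (m + j - mlen β)

/-- `f ∈ S^{∞,d}` is weakly polyhomogeneous with expansion `f ∼ ∑_j F j`, where `F j = f_{m-j}`. -/
structure IsWeaklyPolyhomogeneous (S : TwistedSystem n A) (Γ : Sector) (m d : ℝ)
    (f : E n → ℂ → A) (F : ℕ → E n → ℂ → A) : Prop where
  mem : IsWeakSymbol S Γ (m - d) d f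
  term_mem : ∀ j : ℕ, IsWeakSymbol S Γ (m - j - d) d (F j)
  homogeneous : ∀ (j : ℕ) (ξ : E n) (μ : ℂ) (t : ℝ), 1 ≤ ‖ξ‖ → μ ∈ Γ.carrier → 1 ≤ t →
    F j (t • ξ) (t * μ) = (t ^ (m - j) : ℝ) • F j ξ μ
  remainder : ∀ N : ℕ,
    IsWeakSymbol S Γ (m - d - N) d (fun ξ μ => f ξ μ - ∑ j ∈ Finset.range N, F j ξ μ)

/-- The asymptotic expansion
`G(μ) ∼ ∑_j c_j μ^{p-j} + ∑_k (c'_k log μ + c''_k) μ^{d-k}` as `μ → ∞`, uniformly in closed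
subsectors of `Γ`: every truncation has an error of the order of the first omitted terms. -/
def HasLogExpansion (Γ : Sector) (p d : ℝ) (G : ℂ → ℂ) (c c' c'' : ℕ → ℂ) : Prop :=
  ∀ a b : ℝ, Γ.lo < a → b < Γ.hi → ∀ J K : ℕ, ∃ C : ℝ,
    ∀ μ ∈ Sector.closedSector a b, 1 ≤ ‖μ‖ →
      ‖G μ - ∑ j ∈ Finset.range J, c j * Γ.pow μ (p - j)
          - ∑ k ∈ Finset.range K, (c' k * Γ.log μ + c'' k) * Γ.pow μ (d - k)‖
        ≤ C * (‖μ‖ ^ (p - J) + (1 + Real.log ‖μ‖) * ‖μ‖ ^ (d - K))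

end WeaklyParametric

end

/-!
In the coordinate `w = log μ` closed subsectors become half-strips and `μ ^ s` becomes
`exp (s w)`, so the theorem describes `∫ f(ξ, exp w) dξ` as `re w → ∞`.

A symbol of class `S^{M,d}` has a Taylor expansion in `z = 1/μ` at `z = 0` whose `L`-th remainder is
`O(⟨ξ⟩^{M+L} μ^{d-L})`; if `M + L < -n` it may be integrated over `ξ` and contributes only powers
`μ^{d-k}`. This settles the remainder `f - ∑_{j<N} f_{m-j}` for large `N`, and the part of each
`f_{m-j}` over the unit ball.

Outside the unit ball, homogeneity gives `f_{m-j}(rω, μ) = r^{m-j} f_{m-j}(ω, μ/r)`, so in polar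
coordinates the integral of `f_{m-j}` is `μ^{m-j+n}` times the integral of
`exp (-(m-j+n) s) ∫ f_{m-j}(ω, exp s) dω` along the horizontal half-line ending at `w = log μ`.
It is thus determined up to a constant, the coefficient of `μ^{m-j+n}`, by a function that has an
expansion in the powers `exp ((d-k-(m-j+n)) s)`. The primitive of such a power is again a power,
except in the resonant case `d - k = m - j + n`, where it is `s`: this produces the logarithms.
-/

noncomputable section

namespace WeaklyParametric

open MeasureTheory Filter Topology

section Symbols

variable {n : ℕ} {A : Type*} [CStarAlgebra A]

theorem one_le_jb (ξ : E n) : 1 ≤ jb ξ := by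
  rw [jb, Real.one_le_sqrt]
  nlinarith [sq_nonneg ‖ξ‖]

theorem jb_pos (ξ : E n) : 0 < jb ξ := zero_lt_one.trans_le (one_le_jb ξ)

theorem norm_le_jb (ξ : E n) : ‖ξ‖ ≤ jb ξ :=
  Real.le_sqrt_of_sq_le (by linarith)

theorem continuous_jb : Continuous (jb : E n → ℝ) := by
  unfold jb
  fun_prop

theorem continuous_jb_rpow (s : ℝ) : Continuous fun ξ : E n => jb ξ ^ s :=
  continuous_jb.rpow_const fun ξ => Or.inl (jb_pos ξ).ne'

theorem integrable_jb_rpow {s : ℝ} (hs : s < -(n : ℝ)) : Integrable fun ξ : E n => jb ξ ^ s := by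
  have h := integrable_rpow_neg_one_add_norm_sq (E := E n) (μ := volume) (r := -s)
    (by simp; linarith)
  refine h.congr (Eventually.of_forall fun ξ => ?_)
  simp only [jb, neg_neg]
  rw [← Real.rpow_div_two_eq_sqrt _ (by positivity)]

theorem iteratedFDeriv_of_eq_zero {F : Type*} [NormedAddCommGroup F] [NormedSpace ℝ F]
    {k : ℕ} (hk : k = 0) (g : E n → F) (x : E n) (v : Fin k → E n) :
    iteratedFDeriv ℝ k g x v = g x := by
  subst hk
  simp

theorem pderiv_zero {F : Type*} [NormedAddCommGroup F] [NormedSpace ℝ F]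
    (g : E n → F) (x : E n) : pderiv 0 g x = g x :=
  iteratedFDeriv_of_eq_zero (by simp) g x _

theorem mlen_zero : mlen (0 : Fin n → ℕ) = 0 := by simp [mlen]

theorem pderiv_const_smul {F : Type*} [NormedAddCommGroup F] [NormedSpace ℂ F] (c : ℂ)
    (γ : Fin n → ℕ) (g : E n → F) (x : E n) :
    pderiv γ (fun y => c • g y) x = c • pderiv γ g x := by
  rcases eq_or_ne c 0 with rfl | hc
  · simp only [pderiv, zero_smul, iteratedFDeriv_fun_zero, Pi.zero_apply,
      zero_apply]
  · exact congrArg (fun T => T fun k => EuclideanSpace.single (finSigmaFinEquiv.symm k).1 (1 : ℝ))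
      ((ContinuousLinearEquiv.smulLeft (R₁ := ℝ) (M₁ := F)
        (Units.mk0 c hc)).iteratedFDeriv_comp_left (f := g) (x := x) (i := ∑ i, γ i))

namespace TwistedSystem

variable (S : TwistedSystem n A)

theorem delta_zero (a : A) : S.delta 0 a = a := by
  rw [delta, pderiv_zero, mlen_zero, S.act_zero, pow_zero, one_smul]

theorem delta_const_smul (c : ℂ) (γ : Fin n → ℕ) (a : A) :
    S.delta γ (c • a) = c • S.delta γ a := by
  simp only [delta, map_smul]
  rw [pderiv_const_smul, smul_comm]

variable {S}

theorem IsSymbol.continuous {m : ℝ} {f : E n → A} (hf : S.IsSymbol m f) : Continuous f := by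
  have h := (hf.1.2 0).continuousOn
  simp only [delta_zero] at h
  exact continuousOn_univ.1 h

theorem IsSymbol.exists_norm_le {m : ℝ} {f : E n → A} (hf : S.IsSymbol m f) :
    ∃ C, ∀ ξ, ‖f ξ‖ ≤ C * jb ξ ^ m := by
  obtain ⟨C, hC⟩ := hf.2 0 0
  refine ⟨C, fun ξ => ?_⟩
  simpa [delta_zero, pderiv_zero, mlen_zero] using hC ξ

theorem IsSymbol.integrable {m : ℝ} {f : E n → A} (hf : S.IsSymbol m f) (hm : m < -(n : ℝ)) :
    Integrable f := by
  obtain ⟨C, hC⟩ := hf.exists_norm_le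
  exact ((integrable_jb_rpow hm).const_mul C).mono' hf.continuous.aestronglyMeasurable
    (Eventually.of_forall hC)

theorem IsSymbol.const_smul {m : ℝ} {f : E n → A} (hf : S.IsSymbol m f) (c : ℂ) :
    S.IsSymbol m (fun ξ => c • f ξ) := by
  refine ⟨⟨fun x hx => ?_, fun γ => ?_⟩, fun a b => ?_⟩
  · simp only [IsSmooth, map_smul]
    exact ContDiff.const_smul c (hf.1.1 x hx)
  · simp only [S.delta_const_smul]
    exact ContDiffOn.const_smul c (hf.1.2 γ)
  · obtain ⟨C, hC⟩ := hf.2 a b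
    refine ⟨‖c‖ * C, fun ξ => ?_⟩
    rw [pderiv_const_smul, S.delta_const_smul, norm_smul, mul_assoc]
    exact mul_le_mul_of_nonneg_left (hC ξ) (norm_nonneg c)

/-- The Schwartz map `φ • 1`. These maps suffice to test multipliers: their Fourier transforms are
scalar, so that `P_f (φ • 1)` at `0` is a scalar average of the symbol `f`. -/
def scalarSchwartz (S : TwistedSystem n A) (φ : SchwartzMap (E n) ℂ) : S.SchwartzSmooth :=
  ⟨φ.postcompCLM ((ContinuousLinearMap.id ℂ ℂ).smulRight (1 : A)), by
    constructor
    · intro x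
      simp only [IsSmooth, SchwartzMap.postcompCLM_apply, ContinuousLinearMap.smulRight_apply,
        map_smul, map_one]
      exact contDiff_const
    · intro γ
      refine ⟨φ.postcompCLM ((ContinuousLinearMap.id ℂ ℂ).smulRight (S.delta γ 1)), fun x => ?_⟩
      simp only [SchwartzMap.postcompCLM_apply, ContinuousLinearMap.smulRight_apply,
        ContinuousLinearMap.id_apply]
      exact (S.delta_const_smul (φ x) γ 1).symm⟩

theorem fourier_scalarSchwartz (φ : SchwartzMap (E n) ℂ) (ξ : E n) :
    fourier (S.scalarSchwartz φ).1 ξ =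
      (FourierTransform.fourier φ : SchwartzMap (E n) ℂ) ((2 * Real.pi)⁻¹ • ξ) • (1 : A) := by
  rw [SchwartzMap.fourier_coe, Real.fourier_eq', ← integral_smul_const, fourier]
  refine integral_congr_ae (Eventually.of_forall fun x => ?_)
  simp only [scalarSchwartz, SchwartzMap.postcompCLM_apply, ContinuousLinearMap.smulRight_apply,
    ContinuousLinearMap.id_apply, smul_smul, inner_smul_right, smul_eq_mul]
  congr 3
  push_cast
  field_simp

theorem exists_fourier_eq (S : TwistedSystem n A) {h : E n → ℝ} (hsmooth : ContDiff ℝ ∞ h)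
    (hsupp : HasCompactSupport h) :
    ∃ u : S.SchwartzSmooth, ∀ ξ, fourier u.1 ξ = ((h ξ : ℝ) : ℂ) • (1 : A) := by
  have hsupp' : HasCompactSupport fun ξ => ((h ξ : ℝ) : ℂ) :=
    hsupp.comp_left (g := Complex.ofReal) rfl
  have hsmooth' : ContDiff ℝ ∞ fun ξ => ((h ξ : ℝ) : ℂ) :=
    Complex.ofRealCLM.contDiff.comp hsmooth
  have hpi : (2 * Real.pi) ≠ 0 := by positivity
  let g : SchwartzMap (E n) ℂ := SchwartzMap.compCLMOfContinuousLinearEquiv ℂ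
    (ContinuousLinearEquiv.smulLeft (R₁ := ℝ) (M₁ := E n) (Units.mk0 (2 * Real.pi) hpi))
    (hsupp'.toSchwartzMap hsmooth')
  refine ⟨S.scalarSchwartz (FourierTransformInv.fourierInv g), fun ξ => ?_⟩
  rw [fourier_scalarSchwartz, FourierTransform.fourier_fourierInv_eq]
  congr 1
  change ((h ((2 * Real.pi) • (2 * Real.pi)⁻¹ • ξ) : ℝ) : ℂ) = h ξ
  rw [smul_smul, mul_inv_cancel₀ hpi, one_smul]

theorem multiplier_apply_zero (f : E n → A) (u : S.SchwartzSmooth) :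
    S.multiplier f u 0 = ((2 * Real.pi : ℝ) ^ n)⁻¹ • ∫ ξ : E n, f ξ * fourier u.1 ξ := by
  have hB : S.applyB 0 = 0 := by simp [applyB]
  simp [multiplier, hB, S.act_zero]

theorem HasTraceSymbol.symbol_unique {P : S.SchwartzSmooth → E n → A} {f g : E n → A}
    (hf : S.HasTraceSymbol P f) (hg : S.HasTraceSymbol P g) : f = g := by
  obtain ⟨⟨m, hm, hfm⟩, hfP⟩ := hf
  obtain ⟨⟨m', hm', hgm⟩, hgP⟩ := hg
  have hae : ∀ᵐ ξ, f ξ = g ξ := by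
    refine ae_eq_of_integral_contDiff_smul_eq (hfm.integrable hm).locallyIntegrable
      (hgm.integrable hm').locallyIntegrable fun h hsmooth hsupp => ?_
    obtain ⟨u, hu⟩ := S.exists_fourier_eq hsmooth hsupp
    have hzero := congrFun (congrFun (hfP.trans hgP.symm) u) 0
    rw [multiplier_apply_zero, multiplier_apply_zero] at hzero
    have hint := smul_right_injective A (r := ((2 * Real.pi : ℝ) ^ n)⁻¹) (by positivity) hzero
    simpa [hu] using hint
  exact hfm.continuous.ae_eq_iff_eq volume hgm.continuous |>.1 hae

theorem HasTraceSymbol.tr_eq {f : E n → A} (ψ : A →L[ℂ] ℂ)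
    (hf : S.HasTraceSymbol (S.multiplier f) f) :
    S.Tr ψ (S.multiplier f) = (((2 * Real.pi : ℝ) ^ n)⁻¹ : ℝ) * ψ (∫ ξ, f ξ) := by
  have h : ∃ g, S.HasTraceSymbol (S.multiplier f) g := ⟨f, hf⟩
  rw [Tr, dif_pos h, h.choose_spec.symbol_unique hf, invFourier]
  simp only [inner_zero_right, Complex.ofReal_zero, mul_zero, Complex.exp_zero, one_smul]
  rw [← Complex.coe_smul, map_smul, smul_eq_mul]

end TwistedSystem

end Symbols

section HalfStrip

variable {V : Type*} [NormedAddCommGroup V]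

section HalfLine

variable [NormedSpace ℝ V] [CompleteSpace V] {g g' : ℝ → V} {C α : ℝ}

theorem integrableOn_Ioi_of_norm_deriv_le (hα : 0 < α)
    (hd : ∀ t, 0 ≤ t → HasDerivAt g (g' t) t)
    (hb : ∀ t, 0 ≤ t → ‖g' t‖ ≤ C * Real.exp (-α * t)) : IntegrableOn g' (Set.Ioi 0) := by
  refine ((integrableOn_exp_mul_Ioi (neg_neg_of_pos hα) 0).const_mul C).mono' ?_ ?_
  · refine (aestronglyMeasurable_deriv g _).congr ?_
    filter_upwards [ae_restrict_mem measurableSet_Ioi] with t ht using (hd t ht.le).deriv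
  · filter_upwards [ae_restrict_mem measurableSet_Ioi] with t ht using hb t ht.le

theorem exists_tendsto_of_norm_deriv_le (hα : 0 < α) (hd : ∀ t, 0 ≤ t → HasDerivAt g (g' t) t)
    (hb : ∀ t, 0 ≤ t → ‖g' t‖ ≤ C * Real.exp (-α * t)) : ∃ ℓ, Tendsto g atTop (𝓝 ℓ) :=
  ⟨_, tendsto_limUnder_of_hasDerivAt_of_integrableOn_Ioi (fun t ht => hd t (le_of_lt ht))
    (integrableOn_Ioi_of_norm_deriv_le hα hd hb)⟩

theorem norm_sub_le_of_tendsto (hα : 0 < α) (hd : ∀ t, 0 ≤ t → HasDerivAt g (g' t) t)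
    (hb : ∀ t, 0 ≤ t → ‖g' t‖ ≤ C * Real.exp (-α * t)) {ℓ : V} (hℓ : Tendsto g atTop (𝓝 ℓ)) :
    ‖g 0 - ℓ‖ ≤ C / α := by
  rw [norm_sub_rev, ← integral_Ioi_of_hasDerivAt_of_tendsto' (fun t ht => hd t ht)
    (integrableOn_Ioi_of_norm_deriv_le hα hd hb) hℓ]
  have hbound : ∫ t in Set.Ioi (0 : ℝ), C * Real.exp (-α * t) = C / α := by
    rw [integral_const_mul, integral_exp_mul_Ioi (neg_neg_of_pos hα)]
    simp [div_eq_mul_inv]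
  rw [← hbound]
  refine norm_integral_le_of_norm_le
    ((integrableOn_exp_mul_Ioi (neg_neg_of_pos hα) 0).const_mul C) ?_
  filter_upwards [ae_restrict_mem measurableSet_Ioi] with t ht using hb t ht.le

end HalfLine

/-- The closed half strip `{w : 0 ≤ Re w, a ≤ Im w ≤ b}`, the logarithmic picture of
`{μ : 1 ≤ |μ|}` in a closed sector. -/
def halfStrip (a b : ℝ) : Set ℂ := {w | 0 ≤ w.re ∧ w.im ∈ Set.Icc a b}

theorem add_ofReal_mem_halfStrip {a b : ℝ} {w : ℂ} (hw : w ∈ halfStrip a b) {t : ℝ}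
    (ht : 0 ≤ t) : w + t ∈ halfStrip a b :=
  ⟨by simpa using add_nonneg hw.1 ht, by simpa using hw.2⟩

theorem norm_exp_real_mul (s : ℝ) (w : ℂ) : ‖Complex.exp (s * w)‖ = Real.exp (s * w.re) := by
  simp [Complex.norm_exp]

theorem tendsto_exp_neg_mul_atTop {α : ℝ} (hα : 0 < α) :
    Tendsto (fun t : ℝ => Real.exp (-α * t)) atTop (𝓝 0) :=
  Real.tendsto_exp_atBot.comp (tendsto_id.const_mul_atTop_of_neg (neg_neg_of_pos hα))

variable [NormedSpace ℂ V]

theorem hasDerivAt_comp_add_ofReal {g : ℂ → V} {g' : V} {w : ℂ} {s : ℝ}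
    (h : HasDerivAt g g' (w + s)) : HasDerivAt (fun t : ℝ => g (w + t)) g' s :=
  (HasDerivAt.scomp s h ((Complex.ofRealCLM.hasDerivAt (x := s)).const_add w)).congr_deriv
    (one_smul _ _)

variable {g g' : ℂ → V} {C α a b lo hi : ℝ}

theorem norm_sub_le_of_re_eq (hd : ∀ w ∈ halfStrip a b, HasDerivAt g (g' w) w)
    (hb : ∀ w ∈ halfStrip a b, ‖g' w‖ ≤ C * Real.exp (-α * w.re)) {v w : ℂ}
    (hv : v ∈ halfStrip a b) (hw : w ∈ halfStrip a b) (hvw : v.re = w.re) :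
    ‖g v - g w‖ ≤ C * Real.exp (-α * w.re) * ‖v - w‖ := by
  have hconvex : Convex ℝ (Complex.reLm ⁻¹' {w.re} ∩ Complex.imLm ⁻¹' Set.Icc a b) :=
    ((convex_singleton _).linear_preimage _).inter ((convex_Icc a b).linear_preimage _)
  have hmem : ∀ u ∈ Complex.reLm ⁻¹' {w.re} ∩ Complex.imLm ⁻¹' Set.Icc a b,
      u.re = w.re ∧ u ∈ halfStrip a b := fun u hu => ⟨hu.1, hw.1.trans_eq hu.1.symm, hu.2⟩
  refine hconvex.norm_image_sub_le_of_norm_hasDerivWithin_le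
    (fun u hu => (hd u (hmem u hu).2).hasDerivWithinAt) (fun u hu => ?_) ⟨rfl, hw.2⟩ ⟨hvw, hv.2⟩
  rw [← (hmem u hu).1]
  exact hb u (hmem u hu).2

variable [CompleteSpace V]

theorem exists_tendsto_add_ofReal (hα : 0 < α)
    (hd : ∀ w ∈ halfStrip a b, HasDerivAt g (g' w) w)
    (hb : ∀ w ∈ halfStrip a b, ‖g' w‖ ≤ C * Real.exp (-α * w.re)) {w : ℂ}
    (hw : w ∈ halfStrip a b) : ∃ ℓ, Tendsto (fun t : ℝ => g (w + t)) atTop (𝓝 ℓ) := by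
  refine exists_tendsto_of_norm_deriv_le (C := C * Real.exp (-α * w.re)) hα
    (fun t ht => hasDerivAt_comp_add_ofReal (hd _ (add_ofReal_mem_halfStrip hw ht)))
    fun t ht => (hb _ (add_ofReal_mem_halfStrip hw ht)).trans_eq ?_
  rw [mul_assoc, ← Real.exp_add, ← mul_add, Complex.add_re, Complex.ofReal_re]

theorem norm_sub_le_of_tendsto_add_ofReal (hα : 0 < α)
    (hd : ∀ w ∈ halfStrip a b, HasDerivAt g (g' w) w)
    (hb : ∀ w ∈ halfStrip a b, ‖g' w‖ ≤ C * Real.exp (-α * w.re)) {w : ℂ} {ℓ : V}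
    (hw : w ∈ halfStrip a b) (hℓ : Tendsto (fun t : ℝ => g (w + t)) atTop (𝓝 ℓ)) :
    ‖g w - ℓ‖ ≤ C / α * Real.exp (-α * w.re) := by
  have h := norm_sub_le_of_tendsto (C := C * Real.exp (-α * w.re)) hα
    (fun t ht => hasDerivAt_comp_add_ofReal (hd _ (add_ofReal_mem_halfStrip hw ht)))
    (fun t ht => (hb _ (add_ofReal_mem_halfStrip hw ht)).trans_eq ?_) hℓ
  · rwa [Complex.ofReal_zero, add_zero, mul_div_right_comm] at h
  · rw [mul_assoc, ← Real.exp_add, ← mul_add, Complex.add_re, Complex.ofReal_re]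

theorem exists_common_limit (hlt : lo < hi) (hα : 0 < α)
    (hd : ∀ w, 0 ≤ w.re → w.im ∈ Set.Ioo lo hi → HasDerivAt g (g' w) w)
    (hb : ∀ a b, lo < a → b < hi → ∃ C : ℝ, ∀ w ∈ halfStrip a b,
      ‖g' w‖ ≤ C * Real.exp (-α * w.re)) :
    ∃ ℓ, ∀ w : ℂ, w.im ∈ Set.Ioo lo hi → Tendsto (fun t : ℝ => g (w + t)) atTop (𝓝 ℓ) := by
  have hd' : ∀ a b, lo < a → b < hi → ∀ w ∈ halfStrip a b, HasDerivAt g (g' w) w :=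
    fun a b ha hb w hw => hd w hw.1 ⟨ha.trans_le hw.2.1, hw.2.2.trans_lt hb⟩
  obtain ⟨θ₀, hlo, hhi⟩ := exists_between hlt
  obtain ⟨C₀, hC₀⟩ := hb θ₀ θ₀ hlo hhi
  obtain ⟨ℓ, hℓ⟩ := exists_tendsto_add_ofReal (w := θ₀ * Complex.I) hα
    (hd' _ _ hlo hhi) hC₀ ⟨by simp, by simp⟩
  refine ⟨ℓ, fun w hw => ?_⟩
  have ha : lo < min w.im θ₀ := lt_min hw.1 hlo
  have hb' : max w.im θ₀ < hi := max_lt hw.2 hhi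
  obtain ⟨C, hC⟩ := hb _ _ ha hb'
  set v : ℂ := w.re + θ₀ * Complex.I with hv
  have hshift : Tendsto (fun t : ℝ => g (v + t)) atTop (𝓝 ℓ) := by
    refine (hℓ.comp (tendsto_atTop_add_const_left atTop w.re tendsto_id)).congr fun t => ?_
    simp only [Function.comp, id, hv]
    push_cast
    ring_nf
  refine tendsto_of_tendsto_of_dist hshift ?_
  have hdecay : Tendsto (fun t : ℝ => C * Real.exp (-α * (w.re + t)) * ‖v - w‖) atTop (𝓝 0) := by
    simpa using (((tendsto_exp_neg_mul_atTop hα).comp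
      (tendsto_atTop_add_const_left atTop w.re tendsto_id)).const_mul C).mul_const ‖v - w‖
  refine squeeze_zero' (Eventually.of_forall fun _ => dist_nonneg) ?_ hdecay
  filter_upwards [eventually_ge_atTop (-w.re)] with t ht
  have h := norm_sub_le_of_re_eq (v := v + t) (w := w + t) (hd' _ _ ha hb') hC
    ⟨by simp [hv]; linarith, by simp [hv]⟩ ⟨by simp; linarith, by simp⟩ (by simp [hv])
  simpa [dist_eq_norm] using h

end HalfStrip

section Taylor

variable {V : Type*} [NormedAddCommGroup V] [NormedSpace ℂ V]

/-- The Taylor polynomial `∑_{k<K} z^k τ_k / k!` at `0` with derivatives `τ_k`. -/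
def taylorSum (τ : ℕ → V) (K : ℕ) (z : ℂ) : V :=
  ∑ k ∈ Finset.range K, (z ^ k / k.factorial) • τ k

theorem taylorSum_succ_zero (τ : ℕ → V) (K : ℕ) : taylorSum τ (K + 1) 0 = τ 0 := by
  simp [taylorSum, Finset.sum_range_succ']

theorem continuous_taylorSum (τ : ℕ → V) (K : ℕ) : Continuous (taylorSum τ K) := by
  unfold taylorSum
  fun_prop

theorem hasDerivAt_taylorSum (τ : ℕ → V) (K : ℕ) (z : ℂ) :
    HasDerivAt (taylorSum τ (K + 1)) (taylorSum (fun k => τ (k + 1)) K z) z := by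
  have hterm : ∀ k ∈ Finset.range (K + 1), HasDerivAt (fun z : ℂ => (z ^ k / k.factorial) • τ k)
      (((k * z ^ (k - 1)) / k.factorial : ℂ) • τ k) z := fun k _ =>
    ((hasDerivAt_pow k z).div_const _).smul_const (τ k)
  refine (HasDerivAt.fun_sum hterm).congr_deriv ?_
  rw [Finset.sum_range_succ', taylorSum]
  simp only [Nat.cast_zero, zero_mul, zero_div, zero_smul, add_zero, Nat.add_sub_cancel]
  refine Finset.sum_congr rfl fun k _ => ?_
  have hk : ((k + 1 : ℕ) : ℂ) ≠ 0 := Nat.cast_ne_zero.2 k.succ_ne_zero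
  rw [Nat.factorial_succ, Nat.cast_mul, mul_div_mul_left _ _ hk]

theorem hasDerivAt_exp_neg (w : ℂ) :
    HasDerivAt (fun w : ℂ => Complex.exp (-w)) (-Complex.exp (-w)) w := by
  simpa using (hasDerivAt_neg w).cexp

theorem tendsto_exp_neg_add_ofReal (w : ℂ) :
    Tendsto (fun t : ℝ => Complex.exp (-(w + t))) atTop (𝓝 0) := by
  refine Complex.tendsto_exp_comap_re_atBot.comp (tendsto_comap_iff.2 ?_)
  simpa [Function.comp_def] using
    tendsto_neg_atTop_atBot.comp (tendsto_atTop_add_const_left atTop w.re tendsto_id)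

/-- Taylor's formula in the variable `w = -log z`: the functions `Ψ k` are the derivatives of order
`k` with respect to `z`, and `τ k` are their limits at `z = 0`. -/
theorem norm_sub_taylorSum_le [CompleteSpace V] {a b : ℝ} (K : ℕ) {Ψ : ℕ → ℂ → V} {τ : ℕ → V}
    {C : ℝ} (hd : ∀ k, ∀ w ∈ halfStrip a b, HasDerivAt (Ψ k) (-Complex.exp (-w) • Ψ (k + 1) w) w)
    (hτ : ∀ k, ∀ w ∈ halfStrip a b, Tendsto (fun t : ℝ => Ψ k (w + t)) atTop (𝓝 (τ k)))
    (hC : ∀ w ∈ halfStrip a b, ‖Ψ K w‖ ≤ C) {w : ℂ} (hw : w ∈ halfStrip a b) :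
    ‖Ψ 0 w - taylorSum τ K (Complex.exp (-w))‖ ≤ C * Real.exp (-K * w.re) := by
  induction K generalizing Ψ τ w with
  | zero => simpa [taylorSum] using hC w hw
  | succ K ih =>
    have hC₀ : 0 ≤ C := (norm_nonneg _).trans (hC w hw)
    set R : ℂ → V := fun w => Ψ 0 w - taylorSum τ (K + 1) (Complex.exp (-w)) with hR
    have hRderiv : ∀ w ∈ halfStrip a b, HasDerivAt R (-Complex.exp (-w) •
        (Ψ 1 w - taylorSum (fun k => τ (k + 1)) K (Complex.exp (-w)))) w := fun w hw => by
      rw [smul_sub]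
      exact (hd 0 w hw).sub ((hasDerivAt_taylorSum τ K _).scomp w (hasDerivAt_exp_neg w))
    have hRbound : ∀ w ∈ halfStrip a b, ‖-Complex.exp (-w) •
        (Ψ 1 w - taylorSum (fun k => τ (k + 1)) K (Complex.exp (-w)))‖ ≤
          C * Real.exp (-(K + 1 : ℕ) * w.re) := fun w hw => by
      rw [norm_smul, norm_neg, Complex.norm_exp]
      refine (mul_le_mul_of_nonneg_left (ih (fun k => hd (k + 1)) (fun k => hτ (k + 1)) hC hw)
        (Real.exp_pos _).le).trans_eq ?_
      rw [mul_left_comm, ← Real.exp_add]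
      push_cast
      simp only [Complex.neg_re]
      ring_nf
    have hRlim : Tendsto (fun t : ℝ => R (w + t)) atTop (𝓝 0) := by
      have hsum := ((continuous_taylorSum τ (K + 1)).tendsto 0).comp (tendsto_exp_neg_add_ofReal w)
      rw [taylorSum_succ_zero] at hsum
      simpa [hR] using (hτ 0 w hw).sub hsum
    have h := norm_sub_le_of_tendsto_add_ofReal (by positivity) hRderiv hRbound hw hRlim
    rw [sub_zero] at h
    refine h.trans (mul_le_mul_of_nonneg_right (div_le_self hC₀ ?_) (Real.exp_pos _).le)
    exact_mod_cast Nat.succ_le_succ K.zero_le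

end Taylor

theorem im_mem_Ioo_of_mem_halfStrip {Γ : Sector} {a b : ℝ} (ha : Γ.lo < a) (hb : b < Γ.hi) {w : ℂ}
    (hw : w ∈ halfStrip a b) : w.im ∈ Set.Ioo Γ.lo Γ.hi :=
  ⟨ha.trans_le hw.2.1, hw.2.2.trans_lt hb⟩

theorem norm_le_of_mem_halfStrip {a b : ℝ} {w : ℂ} (hw : w ∈ halfStrip a b) :
    ‖w‖ ≤ (1 + max |a| |b|) * (1 + w.re) := by
  have him : |w.im| ≤ max |a| |b| := abs_le_max_abs_abs hw.2.1 hw.2.2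
  have hre := hw.1
  refine (Complex.norm_le_abs_re_add_abs_im w).trans ?_
  rw [abs_of_nonneg hre]
  nlinarith [mul_nonneg ((abs_nonneg _).trans him) hre]

section LogBound

variable {V : Type*} [NormedAddCommGroup V] {Γ : Sector} {s s' : ℝ} {R R' : ℂ → V}

/-- `R(w) = O(e^{s Re w})`, uniformly in closed half strips. In the variable `μ = e^w` this is the
bound `O(|μ|^s)` in closed subsectors of `Γ`. -/
def PowBound (Γ : Sector) (s : ℝ) (R : ℂ → V) : Prop :=
  ∀ a b, Γ.lo < a → b < Γ.hi → ∃ C : ℝ, ∀ w ∈ halfStrip a b, ‖R w‖ ≤ C * Real.exp (s * w.re)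

/-- `R(w) = O((1 + Re w) e^{s Re w})`, uniformly in closed half strips. In the variable `μ = e^w`
this is the bound `O((1 + log |μ|) |μ|^s)` in closed subsectors of `Γ`. -/
def LogBound (Γ : Sector) (s : ℝ) (R : ℂ → V) : Prop :=
  ∀ a b, Γ.lo < a → b < Γ.hi → ∃ C : ℝ, ∀ w ∈ halfStrip a b,
    ‖R w‖ ≤ C * ((1 + w.re) * Real.exp (s * w.re))

theorem PowBound.logBound (h : PowBound Γ s R) : LogBound Γ s R := by
  intro a b ha hb
  obtain ⟨C, hC⟩ := h a b ha hb
  refine ⟨|C|, fun w hw => (hC w hw).trans ?_⟩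
  have hexp := Real.exp_pos (s * w.re)
  exact mul_le_mul (le_abs_self C) (le_mul_of_one_le_left hexp.le (by linarith [hw.1])) hexp.le
    (abs_nonneg C)

namespace LogBound

theorem congr (h : LogBound Γ s R)
    (hR : ∀ w : ℂ, 0 ≤ w.re → w.im ∈ Set.Ioo Γ.lo Γ.hi → R w = R' w) : LogBound Γ s R' := by
  intro a b ha hb
  obtain ⟨C, hC⟩ := h a b ha hb
  refine ⟨C, fun w hw => ?_⟩
  rw [← hR w hw.1 (im_mem_Ioo_of_mem_halfStrip ha hb hw)]
  exact hC w hw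

theorem add (h : LogBound Γ s R) (h' : LogBound Γ s R') : LogBound Γ s (R + R') := by
  intro a b ha hb
  obtain ⟨C, hC⟩ := h a b ha hb
  obtain ⟨C', hC'⟩ := h' a b ha hb
  refine ⟨C + C', fun w hw => (norm_add_le _ _).trans ?_⟩
  rw [add_mul]
  exact add_le_add (hC w hw) (hC' w hw)

theorem neg (h : LogBound Γ s R) : LogBound Γ s (-R) := by
  simpa only [LogBound, Pi.neg_apply, norm_neg] using h

theorem sub (h : LogBound Γ s R) (h' : LogBound Γ s R') : LogBound Γ s (R - R') := by
  simpa only [sub_eq_add_neg] using h.add h'.neg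

theorem zero : LogBound Γ s (0 : ℂ → V) := fun a b _ _ => ⟨0, fun w _ => by simp⟩

theorem sum {ι : Type*} {t : Finset ι} {r : ι → ℂ → V} (h : ∀ i ∈ t, LogBound Γ s (r i)) :
    LogBound Γ s (∑ i ∈ t, r i) :=
  Finset.sum_induction r (LogBound Γ s) (fun _ _ => add) zero h

theorem mono (h : LogBound Γ s R) (hs : s ≤ s') : LogBound Γ s' R := by
  intro a b ha hb
  obtain ⟨C, hC⟩ := h a b ha hb
  refine ⟨|C|, fun w hw => (hC w hw).trans ?_⟩
  have hre := hw.1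
  gcongr
  exact le_abs_self C

variable [NormedSpace ℂ V]

theorem continuousLinearMap_comp {W : Type*} [NormedAddCommGroup W] [NormedSpace ℂ W]
    (φ : V →L[ℂ] W) (h : LogBound Γ s R) : LogBound Γ s (φ ∘ R) := by
  intro a b ha hb
  obtain ⟨C, hC⟩ := h a b ha hb
  refine ⟨‖φ‖ * C, fun w hw => (φ.le_opNorm _).trans ?_⟩
  rw [mul_assoc]
  exact mul_le_mul_of_nonneg_left (hC w hw) (norm_nonneg φ)

theorem exp_smul_log (x y : V) : LogBound Γ s fun w => Complex.exp (s * w) • (w • x + y) := by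
  intro a b _ _
  refine ⟨(1 + max |a| |b|) * ‖x‖ + ‖y‖, fun w hw => ?_⟩
  rw [norm_smul, norm_exp_real_mul, mul_comm, ← mul_assoc]
  gcongr
  refine (norm_add_le _ _).trans ?_
  rw [norm_smul]
  have hw' := mul_le_mul_of_nonneg_right (norm_le_of_mem_halfStrip hw) (norm_nonneg x)
  nlinarith [mul_nonneg hw.1 (norm_nonneg y)]

theorem eq_zero_of_exp_smul_log {x y : V}
    (h : LogBound Γ (s - 1) fun w => Complex.exp (s * w) • (w • x + y)) : x = 0 ∧ y = 0 := by
  obtain ⟨θ, hlo, hhi⟩ := exists_between Γ.lo_lt_hi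
  obtain ⟨C, hC⟩ := h θ θ hlo hhi
  have hlim : Tendsto (fun t : ℝ => (t + θ * Complex.I : ℂ) • x + y) atTop (𝓝 0) := by
    have hdecay : Tendsto (fun t : ℝ => C * ((1 + t) * Real.exp (-t))) atTop (𝓝 0) := by
      simpa [add_mul] using ((Real.tendsto_pow_mul_exp_neg_atTop_nhds_zero 0).add
        (Real.tendsto_pow_mul_exp_neg_atTop_nhds_zero 1)).const_mul C
    refine squeeze_zero_norm' ?_ hdecay
    filter_upwards [eventually_ge_atTop 0] with t ht
    have hbound := hC (t + θ * Complex.I) ⟨by simpa using ht, by simp⟩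
    have hre : (t + θ * Complex.I : ℂ).re = t := by simp
    rw [norm_smul, norm_exp_real_mul, hre, sub_one_mul, sub_eq_add_neg, Real.exp_add] at hbound
    refine le_of_mul_le_mul_left (hbound.trans_eq ?_) (Real.exp_pos (s * t))
    ring
  have hx : x = 0 := by
    have hshift := (hlim.comp (tendsto_atTop_add_const_right atTop (1 : ℝ) tendsto_id)).sub hlim
    rw [sub_zero] at hshift
    refine tendsto_nhds_unique (tendsto_const_nhds.congr fun t => ?_) hshift
    simp only [Function.comp, id, add_sub_add_right_eq_sub, ← sub_smul]
    push_cast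
    rw [add_sub_cancel_left, one_smul]
  refine ⟨hx, tendsto_nhds_unique tendsto_const_nhds (hlim.congr fun t => ?_)⟩
  rw [hx, smul_zero, zero_add]

end LogBound

end LogBound

section LogSum

variable {V : Type*} [NormedAddCommGroup V] [NormedSpace ℂ V] {Γ : Sector} {d : ℝ} {L L' : ℕ}

/-- The truncated expansion `∑_{k<L} (x_k log μ + y_k) μ^{d-k}` in the variable `w = log μ`. -/
def logSum (d : ℝ) (x y : ℕ → V) (L : ℕ) (w : ℂ) : V :=
  ∑ k ∈ Finset.range L, Complex.exp ((d - k : ℝ) * w) • (w • x k + y k)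

/-- The truncated expansion `∑_{j<N} c_j μ^{p-j}` in the variable `w = log μ`. -/
def powSum (p : ℝ) (c : ℕ → V) (N : ℕ) (w : ℂ) : V :=
  ∑ j ∈ Finset.range N, Complex.exp ((p - j : ℝ) * w) • c j

theorem logSum_zero_left (y : ℕ → V) : logSum d 0 y L = powSum d y L := by
  ext w
  simp [logSum, powSum]

theorem logSum_add (x y x' y' : ℕ → V) :
    logSum d (x + x') (y + y') L = logSum d x y L + logSum d x' y' L := by
  ext w
  simp only [logSum, Pi.add_apply, smul_add, Finset.sum_add_distrib]
  abel

theorem logSum_sub (x y x' y' : ℕ → V) :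
    logSum d (x - x') (y - y') L = logSum d x y L - logSum d x' y' L := by
  rw [eq_sub_iff_add_eq, ← logSum_add, sub_add_cancel, sub_add_cancel]

theorem logSum_sum {ι : Type*} (t : Finset ι) (x y : ι → ℕ → V) :
    logSum d (∑ i ∈ t, x i) (∑ i ∈ t, y i) L = ∑ i ∈ t, logSum d (x i) (y i) L := by
  classical
  induction t using Finset.induction_on with
  | empty => ext w; simp [logSum]
  | insert i t hi ih => rw [Finset.sum_insert hi, Finset.sum_insert hi, Finset.sum_insert hi,
      logSum_add, ih]

theorem logSum_congr {x y x' y' : ℕ → V} (hx : ∀ k < L, x k = x' k) (hy : ∀ k < L, y k = y' k) :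
    logSum d x y L = logSum d x' y' L := by
  ext w
  refine Finset.sum_congr rfl fun k hk => ?_
  rw [hx k (Finset.mem_range.1 hk), hy k (Finset.mem_range.1 hk)]

theorem map_logSum {W : Type*} [NormedAddCommGroup W] [NormedSpace ℂ W] (φ : V →L[ℂ] W)
    (x y : ℕ → V) (w : ℂ) : φ (logSum d x y L w) = logSum d (φ ∘ x) (φ ∘ y) L w := by
  simp [logSum]

theorem map_powSum {W : Type*} [NormedAddCommGroup W] [NormedSpace ℂ W] (φ : V →L[ℂ] W)
    (c : ℕ → V) (w : ℂ) : φ (powSum d c L w) = powSum d (φ ∘ c) L w := by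
  simp [powSum]

theorem logSum_sub_logSum_eq_sum_Ico (x y : ℕ → V) (hL : L ≤ L') (w : ℂ) :
    logSum d x y L' w - logSum d x y L w =
      ∑ k ∈ Finset.Ico L L', Complex.exp ((d - k : ℝ) * w) • (w • x k + y k) := by
  rw [logSum, logSum, Finset.sum_Ico_eq_sub _ hL]

theorem logBound_logSum_sub_logSum (x y : ℕ → V) (hL : L ≤ L') :
    LogBound Γ (d - L) (logSum d x y L' - logSum d x y L) := by
  refine (LogBound.sum (t := Finset.Ico L L')
    (r := fun k w => Complex.exp ((d - k : ℝ) * w) • (w • x k + y k)) fun k hk => ?_).congr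
    fun w _ _ => ?_
  · refine (LogBound.exp_smul_log (x k) (y k)).mono (sub_le_sub_left ?_ d)
    exact_mod_cast (Finset.mem_Ico.1 hk).1
  · rw [Finset.sum_apply, Pi.sub_apply, logSum_sub_logSum_eq_sum_Ico x y hL]

theorem logBound_powSum_sub_powSum (c : ℕ → V) (hL : L ≤ L') :
    LogBound Γ (d - L) (powSum d c L' - powSum d c L) := by
  simpa only [logSum_zero_left] using logBound_logSum_sub_logSum 0 c hL

theorem norm_powSum_sub_powSum_le (c : ℕ → V) (hL : L ≤ L') {w : ℂ} (hw : 0 ≤ w.re) :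
    ‖powSum d c L' w - powSum d c L w‖ ≤
      (∑ j ∈ Finset.Ico L L', ‖c j‖) * Real.exp ((d - L) * w.re) := by
  rw [powSum, powSum, ← Finset.sum_Ico_eq_sub _ hL, Finset.sum_mul]
  refine norm_sum_le_of_le _ fun j hj => ?_
  rw [norm_smul, norm_exp_real_mul, mul_comm]
  have hLj : (L : ℝ) ≤ j := by exact_mod_cast (Finset.mem_Ico.1 hj).1
  gcongr

theorem logBound_sub_logSum_of_le {g : ℂ → V} {x y : ℕ → V} (hL : L ≤ L')
    (h : LogBound Γ (d - L') (g - logSum d x y L')) :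
    LogBound Γ (d - L) (g - logSum d x y L) := by
  have hL' : d - L' ≤ d - L := sub_le_sub_left (by exact_mod_cast hL) d
  simpa only [sub_add_sub_cancel] using (h.mono hL').add (logBound_logSum_sub_logSum x y hL)

theorem eq_zero_of_logBound_logSum {x y : ℕ → V} (h : LogBound Γ (d - L) (logSum d x y L)) :
    ∀ k < L, x k = 0 ∧ y k = 0 := by
  intro k
  induction k using Nat.strong_induction_on with
  | _ k ih =>
    intro hk
    refine LogBound.eq_zero_of_exp_smul_log (Γ := Γ) (s := d - k) ?_
    have hsucc : LogBound Γ (d - (k + 1 : ℕ)) (logSum d x y (k + 1)) := by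
      have hzero : LogBound Γ (d - L) (0 - logSum d x y L) := by simpa using h.neg
      simpa using (logBound_sub_logSum_of_le (Nat.succ_le_of_lt hk) hzero).neg
    rw [Nat.cast_succ, ← sub_sub] at hsucc
    refine hsucc.congr fun w _ _ => ?_
    rw [logSum, Finset.sum_range_succ, Finset.sum_eq_zero, zero_add]
    intro j hj
    obtain ⟨hx, hy⟩ := ih j (Finset.mem_range.1 hj) ((Finset.mem_range.1 hj).trans hk)
    rw [hx, hy, smul_zero, add_zero, smul_zero]

theorem logBound_sub_logSum_of_large {g : ℂ → V} {x y : ℕ → V} {K₀ : ℕ}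
    (h : ∀ K ≥ K₀, LogBound Γ (d - K) (g - logSum d x y K)) (L : ℕ) :
    LogBound Γ (d - L) (g - logSum d x y L) :=
  logBound_sub_logSum_of_le (le_max_left L K₀) (h _ (le_max_right L K₀))

/-- The coefficients `x` and `y` are determined by the function, so the choices made for different
`L` agree. -/
theorem exists_coefficients {p : ℝ} {G : ℂ → V} {c : ℕ → V} {N : ℕ → ℕ} (hmono : Monotone N)
    (hN : ∀ L, p - N L ≤ d - L)
    (h : ∀ L : ℕ, ∃ x y : ℕ → V, LogBound Γ (d - L) (G - powSum p c (N L) - logSum d x y L)) :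
    ∃ x y : ℕ → V, ∀ L : ℕ, LogBound Γ (d - L) (G - powSum p c (N L) - logSum d x y L) := by
  choose x y hxy using h
  have hcoeff : ∀ L L' : ℕ, L ≤ L' → ∀ k < L, x L k = x L' k ∧ y L k = y L' k := by
    intro L L' hL k hk
    have htail := (logBound_powSum_sub_powSum (Γ := Γ) (d := p) c (hmono hL)).mono (hN L)
    have hdiff : LogBound Γ (d - L) (logSum d (x L - x L') (y L - y L') L) := by
      rw [logSum_sub]
      convert ((logBound_sub_logSum_of_le hL (hxy L')).sub (hxy L)).add htail using 1
      abel
    obtain ⟨hx, hy⟩ := eq_zero_of_logBound_logSum hdiff k hk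
    exact ⟨sub_eq_zero.1 hx, sub_eq_zero.1 hy⟩
  refine ⟨fun k => x (k + 1) k, fun k => y (k + 1) k, fun L => ?_⟩
  rw [logSum_congr (fun k hk => (hcoeff (k + 1) L hk k k.lt_succ_self).1)
    (fun k hk => (hcoeff (k + 1) L hk k k.lt_succ_self).2)]
  exact hxy L

end LogSum

namespace Sector

theorem exp_eq_polar (w : ℂ) :
    Complex.exp w = (Real.exp w.re : ℝ) * Complex.exp ((w.im : ℝ) * Complex.I) := by
  rw [Complex.ofReal_exp, ← Complex.exp_add, Complex.re_add_im]

variable {Γ : Sector}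

theorem exp_mem_carrier {w : ℂ} (hw : w.im ∈ Set.Ioo Γ.lo Γ.hi) : Complex.exp w ∈ Γ.carrier :=
  ⟨Real.exp w.re, Real.exp_pos _, w.im, hw, exp_eq_polar w⟩

theorem exp_mem_closedSector {a b : ℝ} {w : ℂ} (hw : w.im ∈ Set.Icc a b) :
    Complex.exp w ∈ closedSector a b :=
  ⟨Real.exp w.re, Real.exp_pos _, w.im, hw, exp_eq_polar w⟩

theorem log_exp {w : ℂ} (hw : w.im ∈ Set.Ioo Γ.lo Γ.hi) : Γ.log (Complex.exp w) = w := by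
  rw [exp_eq_polar, Γ.log_polar (Real.exp_pos _) hw, Real.log_exp, Complex.re_add_im]

theorem pow_exp {w : ℂ} (hw : w.im ∈ Set.Ioo Γ.lo Γ.hi) (s : ℝ) :
    Γ.pow (Complex.exp w) s = Complex.exp (s * w) := by
  rw [pow, log_exp hw]

theorem exists_exp_of_mem_closedSector {a b : ℝ} {μ : ℂ} (hμ : μ ∈ closedSector a b)
    (hone : 1 ≤ ‖μ‖) : ∃ w ∈ halfStrip a b, Complex.exp w = μ := by
  obtain ⟨r, hr, θ, hθ, rfl⟩ := hμ
  have hr1 : 1 ≤ r := by simpa [Complex.norm_exp_ofReal_mul_I, abs_of_pos hr] using hone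
  refine ⟨Real.log r + θ * Complex.I,
    ⟨by simpa using Real.log_nonneg hr1, by simpa using hθ⟩, ?_⟩
  rw [Complex.exp_add, ← Complex.ofReal_exp, Real.exp_log hr]

theorem carrier_eq_image_exp (Γ : Sector) :
    Γ.carrier = Complex.exp '' (Complex.im ⁻¹' Set.Ioo Γ.lo Γ.hi) := by
  ext μ
  constructor
  · rintro ⟨r, hr, θ, hθ, rfl⟩
    refine ⟨Real.log r + θ * Complex.I, by simpa using hθ, ?_⟩
    rw [Complex.exp_add, ← Complex.ofReal_exp, Real.exp_log hr]
  · rintro ⟨w, hw, rfl⟩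
    exact exp_mem_carrier hw

theorem isOpen_carrier (Γ : Sector) : IsOpen Γ.carrier := by
  rw [carrier_eq_image_exp]
  exact Complex.isOpenMap_exp _ (isOpen_Ioo.preimage Complex.continuous_im)

theorem differentiableOn_log (Γ : Sector) : DifferentiableOn ℂ Γ.log Γ.carrier := by
  intro μ hμ
  have hslit : μ * Complex.exp (-(((Γ.lo + Γ.hi) / 2 : ℝ) * Complex.I)) ∈ Complex.slitPlane := by
    rw [carrier_eq_image_exp] at hμ
    obtain ⟨w, ⟨hlo, hhi⟩, rfl⟩ := hμ
    have hwidth := Γ.width_le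
    rw [← Complex.exp_add, Complex.mem_slitPlane_iff_arg, ← Complex.log_im,
      Complex.log_exp (by simp; linarith) (by simp; linarith)]
    exact ⟨by simp; linarith, Complex.exp_ne_zero _⟩
  exact (((differentiableAt_id.mul_const _).clog hslit).add_const _).differentiableWithinAt

theorem differentiableOn_pow (Γ : Sector) (s : ℝ) :
    DifferentiableOn ℂ (fun μ => Γ.pow μ s) Γ.carrier :=
  (Γ.differentiableOn_log.const_mul (s : ℂ)).cexp

end Sector

section ParamSymbol

variable {n : ℕ} {A : Type*} [CStarAlgebra A] {Γ : Sector} {M d : ℝ} {h : E n → ℂ → A}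

/-- The part of the definition of `S^{M,d}(ℝⁿ × Γ, A^∞)` that involves no derivatives in `ξ` and
none in the algebra. The values `|z| ≤ 1` with `1/z` in a closed subsector are written `e^{-w}`
with `w` in a half strip. -/
structure IsParamSymbol (Γ : Sector) (M d : ℝ) (h : E n → ℂ → A) : Prop where
  continuousOn : ContinuousOn (fun p : E n × ℂ => h p.1 p.2) (Set.univ ×ˢ Γ.carrier)
  holomorphic : ∀ ξ, DifferentiableOn ℂ (h ξ) Γ.carrier
  continuous_zDeriv : ∀ (j : ℕ) (z : ℂ), z⁻¹ ∈ Γ.carrier → Continuous (zDeriv Γ d h j z)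
  bound : ∀ (j : ℕ) (a b : ℝ), Γ.lo < a → b < Γ.hi → ∃ C : ℝ,
    ∀ w ∈ halfStrip a b, ∀ ξ : E n, ‖zDeriv Γ d h j (Complex.exp (-w)) ξ‖ ≤ C * jb ξ ^ (M + j)

theorem IsWeakSymbol.isParamSymbol {S : TwistedSystem n A} (hh : IsWeakSymbol S Γ M d h) :
    IsParamSymbol Γ M d h where
  continuousOn := by simpa only [S.delta_zero] using (hh.smooth.2 0).continuousOn
  holomorphic ξ := by simpa only [S.delta_zero] using hh.holomorphic ξ 0
  continuous_zDeriv j z hz := (hh.symbol j z hz).continuous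
  bound j a b ha hb := by
    obtain ⟨C, hC⟩ := hh.uniform j a b ha hb 0 0
    simp only [S.delta_zero, pderiv_zero, mlen_zero, Nat.cast_zero, sub_zero] at hC
    refine ⟨C, fun w hw ξ => hC _ ?_ ?_ ξ⟩
    · rw [← Complex.exp_neg, neg_neg]
      exact Sector.exp_mem_closedSector hw.2
    · simpa [Complex.norm_exp] using hw.1

theorem zDeriv_zero_exp (h : E n → ℂ → A) {w : ℂ} (hw : w.im ∈ Set.Ioo Γ.lo Γ.hi) (ξ : E n) :
    zDeriv Γ d h 0 (Complex.exp (-w)) ξ = Complex.exp (-(d * w)) • h ξ (Complex.exp w) := by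
  rw [zDeriv, iteratedDeriv_zero, ← Complex.exp_neg, neg_neg, Sector.pow_exp hw]
  push_cast
  rw [neg_mul]

theorem exp_smul_taylorSum {V : Type*} [NormedAddCommGroup V] [NormedSpace ℂ V] (ℓ : ℕ → V)
    (K : ℕ) (w : ℂ) : Complex.exp (d * w) • taylorSum ℓ K (Complex.exp (-w)) =
      powSum d (fun k => (k.factorial : ℂ)⁻¹ • ℓ k) K w := by
  rw [taylorSum, powSum, Finset.smul_sum]
  refine Finset.sum_congr rfl fun k _ => ?_
  rw [div_eq_mul_inv, mul_smul, smul_smul, ← Complex.exp_nat_mul, ← Complex.exp_add]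
  push_cast
  ring_nf

/-- The functions `τ k` are the Taylor coefficients of `z^d h(ξ, 1/z)` at `z = 0`, with the
estimates that hold for `h ∈ S^{M,d}`. The remainder is written in the variable `w = -log z`. -/
structure HasTaylorExpansion {V : Type*} [NormedAddCommGroup V] [NormedSpace ℂ V] (Γ : Sector)
    (M d : ℝ) (h : E n → ℂ → V) (τ : ℕ → E n → V) : Prop where
  stronglyMeasurable : ∀ k, StronglyMeasurable (τ k)
  norm_le : ∀ k : ℕ, ∃ C : ℝ, ∀ ξ, ‖τ k ξ‖ ≤ C * jb ξ ^ (M + k)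
  norm_sub_le : ∀ a b : ℝ, Γ.lo < a → b < Γ.hi → ∀ K : ℕ, ∃ C : ℝ, ∀ w ∈ halfStrip a b, ∀ ξ,
    ‖h ξ (Complex.exp w) - powSum d (fun k => τ k ξ) K w‖ ≤
      C * jb ξ ^ (M + K) * Real.exp ((d - K) * w.re)

theorem HasTaylorExpansion.integrable {V : Type*} [NormedAddCommGroup V] [NormedSpace ℂ V]
    {h : E n → ℂ → V} {τ : ℕ → E n → V} (hτ : HasTaylorExpansion Γ M d h τ) {ν : Measure (E n)}
    {k : ℕ} (hν : Integrable (fun ξ => jb ξ ^ (M + k)) ν) : Integrable (τ k) ν := by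
  obtain ⟨C, hC⟩ := hτ.norm_le k
  exact (hν.const_mul C).mono' (hτ.stronglyMeasurable k).aestronglyMeasurable
    (Eventually.of_forall hC)

namespace IsParamSymbol

theorem hasDerivAt_zDeriv (hh : IsParamSymbol Γ M d h) (k : ℕ) (ξ : E n) {w : ℂ}
    (hw : w.im ∈ Set.Ioo Γ.lo Γ.hi) :
    HasDerivAt (fun w => zDeriv Γ d h k (Complex.exp (-w)) ξ)
      (-Complex.exp (-w) • zDeriv Γ d h (k + 1) (Complex.exp (-w)) ξ) w := by
  set U : Set ℂ := {0}ᶜ ∩ (fun z => z⁻¹) ⁻¹' Γ.carrier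
  have hU : IsOpen U :=
    (continuousOn_inv₀ (G₀ := ℂ)).isOpen_inter_preimage isOpen_compl_singleton Γ.isOpen_carrier
  have hinv : DifferentiableOn ℂ (fun z : ℂ => z⁻¹) U := fun z hz =>
    (differentiableAt_inv hz.1).differentiableWithinAt
  have hmaps : Set.MapsTo (fun z : ℂ => z⁻¹) U Γ.carrier := fun z hz => hz.2
  have hdiff : DifferentiableOn ℂ (fun z : ℂ => Γ.pow z⁻¹ (-d) • h ξ z⁻¹) U :=
    ((Γ.differentiableOn_pow (-d)).comp hinv hmaps).smul ((hh.holomorphic ξ).comp hinv hmaps)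
  have hmem : Complex.exp (-w) ∈ U := by
    refine ⟨Complex.exp_ne_zero _, ?_⟩
    rw [Set.mem_preimage, ← Complex.exp_neg, neg_neg]
    exact Sector.exp_mem_carrier hw
  have hanalytic := (hdiff.analyticOnNhd hU).iterated_deriv k _ hmem
  rw [← iteratedDeriv_eq_iterate] at hanalytic
  have hz : HasDerivAt (iteratedDeriv k fun z : ℂ => Γ.pow z⁻¹ (-d) • h ξ z⁻¹)
      (zDeriv Γ d h (k + 1) (Complex.exp (-w)) ξ) (Complex.exp (-w)) := by
    rw [zDeriv, iteratedDeriv_succ]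
    exact hanalytic.differentiableAt.hasDerivAt
  exact hz.scomp w (hasDerivAt_exp_neg w)

theorem exists_tendsto_zDeriv (hh : IsParamSymbol Γ M d h) (k : ℕ) (ξ : E n) :
    ∃ ℓ, ∀ w : ℂ, w.im ∈ Set.Ioo Γ.lo Γ.hi →
      Tendsto (fun t : ℝ => zDeriv Γ d h k (Complex.exp (-(w + t))) ξ) atTop (𝓝 ℓ) := by
  refine exists_common_limit (g := fun w => zDeriv Γ d h k (Complex.exp (-w)) ξ)
    Γ.lo_lt_hi zero_lt_one (fun w _ hw => hh.hasDerivAt_zDeriv k ξ hw) fun a b ha hb => ?_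
  obtain ⟨C, hC⟩ := hh.bound (k + 1) a b ha hb
  refine ⟨C * jb ξ ^ (M + (k + 1 : ℕ)), fun w hw => ?_⟩
  rw [norm_smul, norm_neg, Complex.norm_exp, mul_comm, Complex.neg_re, neg_one_mul]
  exact mul_le_mul_of_nonneg_right (hC w hw ξ) (Real.exp_pos _).le

theorem norm_sub_powSum_le (hh : IsParamSymbol Γ M d h) {ℓ : ℕ → E n → A}
    (hℓ : ∀ k ξ, ∀ w : ℂ, w.im ∈ Set.Ioo Γ.lo Γ.hi →
      Tendsto (fun t : ℝ => zDeriv Γ d h k (Complex.exp (-(w + t))) ξ) atTop (𝓝 (ℓ k ξ)))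
    {a b : ℝ} (ha : Γ.lo < a) (hb : b < Γ.hi) (K : ℕ) : ∃ C : ℝ, ∀ w ∈ halfStrip a b, ∀ ξ,
      ‖h ξ (Complex.exp w) - powSum d (fun k => (k.factorial : ℂ)⁻¹ • ℓ k ξ) K w‖ ≤
        C * jb ξ ^ (M + K) * Real.exp ((d - K) * w.re) := by
  obtain ⟨C, hC⟩ := hh.bound K a b ha hb
  have him := fun w (hw : w ∈ halfStrip a b) => im_mem_Ioo_of_mem_halfStrip ha hb hw
  refine ⟨C, fun w hw ξ => ?_⟩
  have htaylor := norm_sub_taylorSum_le K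
    (Ψ := fun k w => zDeriv Γ d h k (Complex.exp (-w)) ξ) (τ := fun k => ℓ k ξ)
    (fun k w hw => hh.hasDerivAt_zDeriv k ξ (him w hw)) (fun k w hw => hℓ k ξ w (him w hw))
    (fun w hw => hC w hw ξ) hw
  rw [zDeriv_zero_exp h (him w hw)] at htaylor
  rw [← exp_smul_taylorSum, ← one_smul ℂ (h ξ (Complex.exp w)), ← Complex.exp_zero,
    ← add_neg_cancel (d * w : ℂ), Complex.exp_add, mul_smul, ← smul_sub, norm_smul,
    norm_exp_real_mul, sub_eq_add_neg d (K : ℝ), add_mul, Real.exp_add, mul_left_comm]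
  exact mul_le_mul_of_nonneg_left htaylor (Real.exp_pos _).le

theorem exists_hasTaylorExpansion (hh : IsParamSymbol Γ M d h) :
    ∃ τ, HasTaylorExpansion Γ M d h τ := by
  choose ℓ hℓ using hh.exists_tendsto_zDeriv
  obtain ⟨θ, hlo, hhi⟩ := exists_between Γ.lo_lt_hi
  have him : (θ * Complex.I : ℂ).im ∈ Set.Ioo Γ.lo Γ.hi := by simpa using ⟨hlo, hhi⟩
  refine ⟨fun k ξ => (k.factorial : ℂ)⁻¹ • ℓ k ξ, fun k => ?_, fun k => ?_,
    fun a b ha hb => hh.norm_sub_powSum_le hℓ ha hb⟩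
  · refine StronglyMeasurable.const_smul (stronglyMeasurable_of_tendsto atTop
      (f := fun (t : ℝ) ξ => zDeriv Γ d h k (Complex.exp (-(θ * Complex.I + t))) ξ)
      (fun t => (hh.continuous_zDeriv k _ ?_).stronglyMeasurable)
      (tendsto_pi_nhds.2 fun ξ => hℓ k ξ _ him)) _
    rw [← Complex.exp_neg, neg_neg]
    exact Sector.exp_mem_carrier (by simpa using him)
  · obtain ⟨C, hC⟩ := hh.bound k θ θ hlo hhi
    refine ⟨C, fun ξ => ?_⟩
    have hlim : ‖ℓ k ξ‖ ≤ C * jb ξ ^ (M + k) := by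
      refine le_of_tendsto (hℓ k ξ _ him).norm ?_
      filter_upwards [eventually_ge_atTop 0] with t ht
      exact hC _ ⟨by simpa using ht, by simp⟩ ξ
    rw [norm_smul, norm_inv, Complex.norm_natCast]
    exact (mul_le_of_le_one_left (norm_nonneg _)
      (inv_le_one_of_one_le₀ (by exact_mod_cast k.factorial_pos))).trans hlim

theorem continuous_exp (hh : IsParamSymbol Γ M d h) {w : ℂ} (hw : w.im ∈ Set.Ioo Γ.lo Γ.hi) :
    Continuous fun ξ => h ξ (Complex.exp w) :=
  hh.continuousOn.comp_continuous (f := fun ξ : E n => (ξ, Complex.exp w)) (by fun_prop)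
    fun _ => ⟨Set.mem_univ _, Sector.exp_mem_carrier hw⟩

theorem norm_le (hh : IsParamSymbol Γ M d h) {a b : ℝ} (ha : Γ.lo < a) (hb : b < Γ.hi) :
    ∃ C : ℝ, ∀ w ∈ halfStrip a b, ∀ ξ,
      ‖h ξ (Complex.exp w)‖ ≤ C * jb ξ ^ M * Real.exp (d * w.re) := by
  obtain ⟨τ, hτ⟩ := hh.exists_hasTaylorExpansion
  simpa [powSum] using hτ.norm_sub_le a b ha hb 0

theorem integrable (hh : IsParamSymbol Γ M d h) {ν : Measure (E n)}
    (hν : Integrable (fun ξ => jb ξ ^ M) ν) {w : ℂ} (hre : 0 ≤ w.re)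
    (him : w.im ∈ Set.Ioo Γ.lo Γ.hi) : Integrable (fun ξ => h ξ (Complex.exp w)) ν := by
  obtain ⟨C, hC⟩ := hh.norm_le him.1 him.2
  exact ((hν.const_mul C).mul_const _).mono' (hh.continuous_exp him).aestronglyMeasurable
    (Eventually.of_forall (hC w ⟨hre, le_rfl, le_rfl⟩))

theorem powBound_integral_sub_powSum (hh : IsParamSymbol Γ M d h) {τ : ℕ → E n → A}
    (hτ : HasTaylorExpansion Γ M d h τ) {ν : Measure (E n)} {K : ℕ}
    (hν : ∀ k ≤ K, Integrable (fun ξ => jb ξ ^ (M + k)) ν) :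
    PowBound Γ (d - K)
      ((fun w => ∫ ξ, h ξ (Complex.exp w) ∂ν) - powSum d (fun k => ∫ ξ, τ k ξ ∂ν) K) := by
  intro a b ha hb
  obtain ⟨C, hC⟩ := hτ.norm_sub_le a b ha hb K
  refine ⟨C * ∫ ξ, jb ξ ^ (M + K) ∂ν, fun w hw => ?_⟩
  have hint : Integrable (fun ξ => h ξ (Complex.exp w)) ν :=
    hh.integrable (by simpa using hν 0 K.zero_le) hw.1 (im_mem_Ioo_of_mem_halfStrip ha hb hw)
  have hterm : ∀ k ∈ Finset.range K,
      Integrable (fun ξ => Complex.exp ((d - k : ℝ) * w) • τ k ξ) ν := fun k hk =>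
    (hτ.integrable (hν k (Finset.mem_range.1 hk).le)).smul (Complex.exp ((d - k : ℝ) * w))
  have hsumint : Integrable (fun ξ => powSum d (fun k => τ k ξ) K w) ν :=
    integrable_finsetSum _ hterm
  have hsum : powSum d (fun k => ∫ ξ, τ k ξ ∂ν) K w = ∫ ξ, powSum d (fun k => τ k ξ) K w ∂ν := by
    simp only [powSum, ← integral_smul, integral_finsetSum _ hterm]
  rw [Pi.sub_apply, hsum, ← integral_sub hint hsumint, ← integral_const_mul,
    ← integral_mul_const]
  exact norm_integral_le_of_norm_le (((hν K le_rfl).const_mul C).mul_const _)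
    (Eventually.of_forall (hC w hw))

end IsParamSymbol

end ParamSymbol

section HolomorphicParameter

variable {X V : Type*} [MeasurableSpace X] {ν : Measure X} [NormedAddCommGroup V]
  [NormedSpace ℂ V] {F : X → ℂ → V} {bound : X → ℝ} {w₀ : ℂ} {r : ℝ}

theorem aestronglyMeasurable_deriv_of_differentiableOn_ball (hr : 0 < r)
    (hmeas : ∀ w ∈ Metric.ball w₀ r, AEStronglyMeasurable (fun x => F x w) ν)
    (hdiff : ∀ᵐ x ∂ν, DifferentiableOn ℂ (F x) (Metric.ball w₀ r)) :
    AEStronglyMeasurable (fun x => deriv (F x) w₀) ν := by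
  obtain ⟨u, -, hu, hu₀⟩ := exists_seq_strictAnti_tendsto' hr
  have hmem : ∀ k, w₀ + (u k : ℂ) ∈ Metric.ball w₀ r := fun k => by
    simpa [abs_of_pos (hu k).1] using (hu k).2
  have hpunctured : Tendsto (fun k => (u k : ℂ)) atTop (𝓝[≠] 0) :=
    tendsto_nhdsWithin_iff.2 ⟨by exact_mod_cast (Complex.continuous_ofReal.tendsto 0).comp hu₀,
      Eventually.of_forall fun k => Complex.ofReal_ne_zero.2 (hu k).1.ne'⟩
  refine aestronglyMeasurable_of_tendsto_ae atTop
    (f := fun k x => (u k : ℂ)⁻¹ • (F x (w₀ + u k) - F x w₀))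
    (fun k => ((hmeas _ (hmem k)).sub (hmeas _ (Metric.mem_ball_self hr))).const_smul _) ?_
  filter_upwards [hdiff] with x hx
  have hderiv := hx.differentiableAt (Metric.ball_mem_nhds w₀ hr) |>.hasDerivAt
  exact hderiv.tendsto_slope_zero.comp hpunctured

theorem norm_deriv_le_of_norm_le_ball {f : ℂ → V} {C : ℝ} (hr : 0 < r)
    (hf : DifferentiableOn ℂ f (Metric.ball w₀ r)) (hC : ∀ w ∈ Metric.ball w₀ r, ‖f w‖ ≤ C)
    {w : ℂ} (hw : w ∈ Metric.ball w₀ (r / 2)) : ‖deriv f w‖ ≤ C / (r / 3) := by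
  have hball : Metric.closedBall w (r / 3) ⊆ Metric.ball w₀ r :=
    Metric.closedBall_subset_ball' (by linarith [Metric.mem_ball.1 hw])
  exact Complex.norm_deriv_le_of_forall_mem_sphere_norm_le (by positivity)
    (hf.diffContOnCl_ball hball) fun z hz => hC z (hball (Metric.sphere_subset_closedBall hz))

theorem hasDerivAt_integral_of_differentiableOn_ball (hr : 0 < r)
    (hmeas : ∀ w ∈ Metric.ball w₀ r, AEStronglyMeasurable (fun x => F x w) ν)
    (hdiff : ∀ᵐ x ∂ν, DifferentiableOn ℂ (F x) (Metric.ball w₀ r))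
    (hbound : ∀ᵐ x ∂ν, ∀ w ∈ Metric.ball w₀ r, ‖F x w‖ ≤ bound x) (hint : Integrable bound ν) :
    Integrable (fun x => deriv (F x) w₀) ν ∧
      HasDerivAt (fun w => ∫ x, F x w ∂ν) (∫ x, deriv (F x) w₀ ∂ν) w₀ := by
  refine hasDerivAt_integral_of_dominated_loc_of_deriv_le (F := fun w x => F x w)
    (F' := fun w x => deriv (F x) w) (Metric.ball_mem_nhds w₀ (half_pos hr))
    (Filter.mem_of_superset (Metric.ball_mem_nhds w₀ hr) hmeas) ?_
    (aestronglyMeasurable_deriv_of_differentiableOn_ball hr hmeas hdiff) ?_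
    (hint.div_const (r / 3)) ?_
  · refine hint.mono' (hmeas _ (Metric.mem_ball_self hr)) ?_
    filter_upwards [hbound] with x hx using hx _ (Metric.mem_ball_self hr)
  · filter_upwards [hdiff, hbound] with x hx hxb w hw
    exact norm_deriv_le_of_norm_le_ball hr hx hxb hw
  · filter_upwards [hdiff] with x hx w hw
    exact (hx.differentiableAt (Metric.isOpen_ball.mem_nhds
      (Metric.ball_subset_ball (half_le_self hr.le) hw))).hasDerivAt

end HolomorphicParameter

section HorizontalIntegral

variable {V : Type*} [NormedAddCommGroup V] [NormedSpace ℂ V] {q : ℂ → V} {lo hi ε : ℝ}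

/-- The integral of `q` over the horizontal half line from `-∞` to `w`: the primitive of `q` that
vanishes at `Re w = -∞`. -/
def horizontalIntegral (q : ℂ → V) (w : ℂ) : V := ∫ t in Set.Ioi (0 : ℝ), q (w - t)

theorem exists_ball_subset_strip {w₀ : ℂ} (hw₀ : w₀.im ∈ Set.Ioo lo hi) :
    ∃ r a b : ℝ, 0 < r ∧ lo < a ∧ b < hi ∧
      ∀ w ∈ Metric.ball w₀ r, w.re ≤ w₀.re + r ∧ w.im ∈ Set.Icc a b := by
  obtain ⟨a, hlo, ha⟩ := exists_between hw₀.1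
  obtain ⟨b, hb, hhi⟩ := exists_between hw₀.2
  refine ⟨min (w₀.im - a) (b - w₀.im), a, b, lt_min (sub_pos.2 ha) (sub_pos.2 hb), hlo, hhi,
    fun w hw => ?_⟩
  rw [mem_ball_iff_norm] at hw
  have hre := abs_le.1 ((Complex.abs_re_le_norm (w - w₀)).trans hw.le)
  have him := abs_le.1 ((Complex.abs_im_le_norm (w - w₀)).trans hw.le)
  rw [Complex.sub_re] at hre
  rw [Complex.sub_im] at him
  exact ⟨by linarith, by linarith [min_le_left (w₀.im - a) (b - w₀.im)],
    by linarith [min_le_right (w₀.im - a) (b - w₀.im)]⟩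

theorem hasDerivAt_comp_sub_ofReal {q' : V} {w : ℂ} {t : ℝ} (h : HasDerivAt q q' (w - t)) :
    HasDerivAt (fun s : ℝ => q (w - s)) (-q') t :=
  (HasDerivAt.scomp t h ((Complex.ofRealCLM.hasDerivAt (x := t)).const_sub w)).congr_deriv
    (by simp)

theorem le_exp_mul_exp_neg {y D X t : ℝ} {w : ℂ} (hε : 0 ≤ ε) (hX : w.re ≤ X)
    (hy : y ≤ D * Real.exp (ε * (w - t : ℂ).re)) :
    y ≤ |D| * Real.exp (ε * X) * Real.exp (-ε * t) := by
  refine hy.trans ?_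
  rw [mul_assoc, ← Real.exp_add, Complex.sub_re, Complex.ofReal_re]
  gcongr
  · exact le_abs_self D
  · nlinarith

theorem hasDerivAt_horizontalIntegral [CompleteSpace V] (hε : 0 < ε)
    (hq : DifferentiableOn ℂ q (Complex.im ⁻¹' Set.Ioo lo hi))
    (hb : ∀ a b X, lo < a → b < hi → ∃ D : ℝ, ∀ w : ℂ, w.re ≤ X → w.im ∈ Set.Icc a b →
      ‖q w‖ ≤ D * Real.exp (ε * w.re)) {w₀ : ℂ} (hw₀ : w₀.im ∈ Set.Ioo lo hi) :
    HasDerivAt (horizontalIntegral q) (q w₀) w₀ := by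
  obtain ⟨r, a, b, hr, ha, hb', hball⟩ := exists_ball_subset_strip hw₀
  obtain ⟨D, hD⟩ := hb a b (w₀.re + r) ha hb'
  have hball₀ := Metric.mem_ball_self (x := w₀) hr
  have hat : ∀ w ∈ Metric.ball w₀ r, ∀ t : ℝ, DifferentiableAt ℂ q (w - t) := fun w hw t =>
    hq.differentiableAt ((isOpen_Ioo.preimage Complex.continuous_im).mem_nhds
      (by simpa using ⟨ha.trans_le (hball w hw).2.1, (hball w hw).2.2.trans_lt hb'⟩))
  have hbound : ∀ w ∈ Metric.ball w₀ r, ∀ t : ℝ, 0 ≤ t →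
      ‖q (w - t)‖ ≤ |D| * Real.exp (ε * (w₀.re + r)) * Real.exp (-ε * t) := fun w hw t ht => by
    obtain ⟨hre, him⟩ := hball w hw
    exact le_exp_mul_exp_neg hε.le hre (hD (w - t) (by simp; linarith) (by simpa using him))
  have hint : IntegrableOn (fun t => |D| * Real.exp (ε * (w₀.re + r)) * Real.exp (-ε * t))
      (Set.Ioi 0) := (integrableOn_exp_mul_Ioi (neg_neg_of_pos hε) 0).const_mul _
  have hderiv : ∀ t : ℝ, HasDerivAt (fun s : ℝ => q (w₀ - s)) (-deriv q (w₀ - t)) t := fun t =>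
    hasDerivAt_comp_sub_ofReal (hat w₀ hball₀ t).hasDerivAt
  have hlim : Tendsto (fun t : ℝ => q (w₀ - t)) atTop (𝓝 0) := by
    refine squeeze_zero_norm' ((eventually_ge_atTop 0).mono (hbound w₀ hball₀)) ?_
    simpa using (tendsto_exp_neg_mul_atTop hε).const_mul (|D| * Real.exp (ε * (w₀.re + r)))
  obtain ⟨hderivint, hmain⟩ := hasDerivAt_integral_of_differentiableOn_ball
    (F := fun (t : ℝ) w => q (w - t)) (ν := volume.restrict (Set.Ioi 0)) hr
    (fun w hw => (continuous_iff_continuousAt.2 fun t => (hasDerivAt_comp_sub_ofReal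
      (hat w hw t).hasDerivAt).continuousAt).aestronglyMeasurable)
    (Eventually.of_forall fun t w hw =>
      ((hat w hw t).comp w (differentiableAt_id.sub_const (t : ℂ))).differentiableWithinAt)
    (by filter_upwards [ae_restrict_mem measurableSet_Ioi] with t ht w hw
        exact hbound w hw t (le_of_lt ht)) hint
  simp only [deriv_comp_sub_const] at hderivint hmain
  have hftc := integral_Ioi_of_hasDerivAt_of_tendsto' (fun t _ => hderiv t) hderivint.neg hlim
  rw [integral_neg, zero_sub, Complex.ofReal_zero, sub_zero, neg_inj] at hftc
  rwa [hftc] at hmain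

end HorizontalIntegral

section LogarithmicPrimitive

variable {V : Type*} [NormedAddCommGroup V] [NormedSpace ℂ V] {Γ : Sector} {d p s : ℝ}
  {g : ℕ → V} {K K₀ : ℕ}

/-- A primitive of `w ↦ e^{sw}`. In the resonant case `s = 0` it is the logarithm `w = log μ`. -/
def expPrimitive (s : ℝ) (w : ℂ) : ℂ := if s = 0 then w else Complex.exp (s * w) / s

theorem hasDerivAt_expPrimitive (s : ℝ) (w : ℂ) :
    HasDerivAt (expPrimitive s) (Complex.exp (s * w)) w := by
  unfold expPrimitive
  split_ifs with hs
  · simpa [hs] using hasDerivAt_id' w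
  · have hs' : (s : ℂ) ≠ 0 := Complex.ofReal_ne_zero.2 hs
    exact (((hasDerivAt_id w).const_mul (s : ℂ)).cexp.div_const (s : ℂ)).congr_deriv
      (by field_simp; simp)

theorem tendsto_expPrimitive_add_ofReal (hs : s < 0) (w : ℂ) :
    Tendsto (fun t : ℝ => expPrimitive s (w + t)) atTop (𝓝 0) := by
  simp only [expPrimitive, if_neg hs.ne]
  rw [← zero_div (s : ℂ)]
  refine Tendsto.div_const (tendsto_zero_iff_norm_tendsto_zero.2 ?_) _
  simp only [norm_exp_real_mul, Complex.add_re, Complex.ofReal_re]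
  refine Real.tendsto_exp_atBot.comp (Tendsto.const_mul_atTop_of_neg hs ?_)
  exact tendsto_atTop_add_const_left atTop w.re tendsto_id

/-- The termwise primitive of `powSum s g K`. -/
def primitiveSum (s : ℝ) (g : ℕ → V) (K : ℕ) (w : ℂ) : V :=
  ∑ k ∈ Finset.range K, expPrimitive (s - k) w • g k

theorem hasDerivAt_primitiveSum (w : ℂ) :
    HasDerivAt (primitiveSum s g K) (powSum s g K w) w :=
  HasDerivAt.fun_sum fun k _ => (hasDerivAt_expPrimitive (s - k) w).smul_const (g k)

theorem tendsto_primitiveSum_sub (hK : K₀ ≤ K) (hs : s < K₀) (w : ℂ) :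
    Tendsto (fun t : ℝ => primitiveSum s g K (w + t) - primitiveSum s g K₀ (w + t)) atTop
      (𝓝 0) := by
  simp only [primitiveSum, ← Finset.sum_Ico_eq_sub _ hK]
  rw [← Finset.sum_const_zero (s := Finset.Ico K₀ K)]
  refine tendsto_finsetSum _ fun k hk => ?_
  have hk' : s - k < 0 := sub_neg.2 (hs.trans_le (by exact_mod_cast (Finset.mem_Ico.1 hk).1))
  simpa using (tendsto_expPrimitive_add_ofReal hk' w).smul_const (g k)

theorem exp_smul_primitiveSum : ∃ x y : ℕ → V, ∀ (K : ℕ) (w : ℂ),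
    Complex.exp (p * w) • primitiveSum (d - p) g K w = logSum d x y K w := by
  refine ⟨fun k => if d - p - k = 0 then g k else 0,
    fun k => if d - p - k = 0 then 0 else ((d - p - k : ℝ) : ℂ)⁻¹ • g k, fun K w => ?_⟩
  rw [primitiveSum, logSum, Finset.smul_sum]
  refine Finset.sum_congr rfl fun k _ => ?_
  rw [smul_smul, expPrimitive]
  split_ifs with hk
  · rw [add_zero, smul_smul, show p = d - k by linarith]
  · rw [smul_zero, zero_add, smul_smul, div_eq_mul_inv, ← mul_assoc, ← Complex.exp_add]
    push_cast
    ring_nf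

theorem exp_neg_smul_powSum (w : ℂ) :
    Complex.exp ((-p : ℝ) * w) • powSum d g K w = powSum (d - p) g K w := by
  rw [powSum, powSum, Finset.smul_sum]
  refine Finset.sum_congr rfl fun k _ => ?_
  rw [smul_smul, ← Complex.exp_add]
  push_cast
  ring_nf

theorem norm_exp_neg_smul_sub_powSum_le {R : V} {C : ℝ} {w : ℂ}
    (h : ‖R‖ ≤ C * Real.exp ((d - K) * w.re)) :
    ‖Complex.exp ((-p : ℝ) * w) • R‖ ≤ C * Real.exp (-(K - (d - p)) * w.re) := by
  rw [norm_smul, norm_exp_real_mul]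
  refine (mul_le_mul_of_nonneg_left h (Real.exp_pos _).le).trans_eq ?_
  rw [mul_left_comm, ← Real.exp_add]
  ring_nf

/-- The constant of integration contributes `e^{pw} c`. The logarithm comes from the resonant term
`e^{(d-k)w}` with `d - k = p`. -/
theorem exists_logBound_of_hasDerivAt [CompleteSpace V] {P I : ℂ → V}
    (hP : ∀ w, 0 ≤ w.re → w.im ∈ Set.Ioo Γ.lo Γ.hi →
      HasDerivAt P (Complex.exp ((-p : ℝ) * w) • I w) w)
    (hI : ∀ K : ℕ, PowBound Γ (d - K) (I - powSum d g K)) :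
    ∃ (c : V) (x y : ℕ → V), ∀ L : ℕ, LogBound Γ (d - L)
      ((fun w => Complex.exp (p * w) • (P w - c)) - logSum d x y L) := by
  obtain ⟨x, y, hxy⟩ := exp_smul_primitiveSum (p := p) (d := d) (g := g)
  obtain ⟨K₀, hK₀⟩ := exists_nat_gt (d - p)
  have hrate : ∀ K ≥ K₀, 0 < K - (d - p) := fun K hK =>
    sub_pos.2 (hK₀.trans_le (by exact_mod_cast hK))
  have hderiv : ∀ K w, 0 ≤ w.re → w.im ∈ Set.Ioo Γ.lo Γ.hi →
      HasDerivAt (fun w => P w - primitiveSum (d - p) g K w)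
        (Complex.exp ((-p : ℝ) * w) • (I w - powSum d g K w)) w := fun K w hre him => by
    rw [smul_sub, exp_neg_smul_powSum]
    exact (hP w hre him).sub (hasDerivAt_primitiveSum w)
  obtain ⟨c, hc⟩ := exists_common_limit Γ.lo_lt_hi (hrate K₀ le_rfl) (hderiv K₀)
    fun a b ha hb => (hI K₀ a b ha hb).imp fun C hC w hw =>
      norm_exp_neg_smul_sub_powSum_le (hC w hw)
  have hlim : ∀ K ≥ K₀, ∀ w : ℂ, w.im ∈ Set.Ioo Γ.lo Γ.hi →
      Tendsto (fun t : ℝ => P (w + t) - primitiveSum (d - p) g K (w + t)) atTop (𝓝 c) :=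
    fun K hK w hw => by
      simpa using (hc w hw).sub (tendsto_primitiveSum_sub (g := g) hK hK₀ w)
  refine ⟨c, x, y, logBound_sub_logSum_of_large (K₀ := K₀) fun K hK =>
    PowBound.logBound fun a b ha hb => ?_⟩
  obtain ⟨C, hC⟩ := hI K a b ha hb
  refine ⟨C / (K - (d - p)), fun w hw => ?_⟩
  have him : ∀ w ∈ halfStrip a b, w.im ∈ Set.Ioo Γ.lo Γ.hi := fun w =>
    im_mem_Ioo_of_mem_halfStrip ha hb
  have hremainder := norm_sub_le_of_tendsto_add_ofReal (hrate K hK)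
    (fun w hw => hderiv K w hw.1 (him w hw))
    (fun w hw => norm_exp_neg_smul_sub_powSum_le (hC w hw)) hw (hlim K hK w (him w hw))
  rw [Pi.sub_apply, ← hxy, ← smul_sub, norm_smul, norm_exp_real_mul, sub_right_comm]
  refine (mul_le_mul_of_nonneg_left hremainder (Real.exp_pos _).le).trans_eq ?_
  rw [mul_left_comm, ← Real.exp_add]
  ring_nf

end LogarithmicPrimitive

section PolarCoordinates

variable {X V : Type*} [NormedAddCommGroup X] [NormedSpace ℝ X]

theorem comp_homeomorphUnitSphereProd (h : X → V) :
    (fun p : Metric.sphere (0 : X) 1 × Set.Ioi (0 : ℝ) => h (p.2.1 • p.1.1)) ∘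
      homeomorphUnitSphereProd X = h ∘ Subtype.val := by
  funext ξ
  rw [Function.comp_apply, ← homeomorphUnitSphereProd_symm_apply_coe,
    Homeomorph.symm_apply_apply, Function.comp_apply]

variable [FiniteDimensional ℝ X] [MeasurableSpace X] [BorelSpace X] {μ : Measure X}
  [μ.IsAddHaarMeasure] [NormedAddCommGroup V]

theorem integrable_polar {h : X → V} (hh : Integrable h μ) :
    Integrable (fun p : Metric.sphere (0 : X) 1 × Set.Ioi (0 : ℝ) => h (p.2.1 • p.1.1))
      (μ.toSphere.prod (Measure.volumeIoiPow (Module.finrank ℝ X - 1))) := by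
  rw [← μ.measurePreserving_homeomorphUnitSphereProd.integrable_comp_emb
    (Homeomorph.measurableEmbedding _), comp_homeomorphUnitSphereProd,
    ← integrableOn_iff_comap_subtypeVal (measurableSet_singleton _).compl]
  exact hh.integrableOn

variable [NormedSpace ℝ V]

theorem integral_volumeIoiPow (k : ℕ) (g : ℝ → V) :
    ∫ r : Set.Ioi (0 : ℝ), g r ∂Measure.volumeIoiPow k = ∫ r in Set.Ioi (0 : ℝ), r ^ k • g r := by
  simp only [Measure.volumeIoiPow, ENNReal.ofReal]
  rw [integral_withDensity_eq_integral_smul (by fun_prop),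
    integral_subtype_comap measurableSet_Ioi fun r => Real.toNNReal (r ^ k) • g r,
    setIntegral_congr_fun measurableSet_Ioi fun r hr => ?_]
  rw [NNReal.smul_def, Real.coe_toNNReal _ (pow_nonneg hr.out.le _)]

theorem setIntegral_compl_zero_eq_polar {h : X → V} (hh : Integrable h μ) :
    ∫ ξ in {0}ᶜ, h ξ ∂μ =
      ∫ r in Set.Ioi (0 : ℝ), r ^ (Module.finrank ℝ X - 1) •
        ∫ η : Metric.sphere (0 : X) 1, h (r • (η : X)) ∂μ.toSphere := by
  rw [← integral_volumeIoiPow, ← integral_prod_symm _ (integrable_polar hh),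
    ← μ.measurePreserving_homeomorphUnitSphereProd.integral_comp
      (Homeomorph.measurableEmbedding _),
    ← integral_subtype_comap (measurableSet_singleton _).compl]
  exact congrArg (integral _) (comp_homeomorphUnitSphereProd h).symm

theorem setIntegral_compl_closedBall_eq_polar {h : X → V}
    (hh : IntegrableOn h (Metric.closedBall 0 1)ᶜ μ) :
    ∫ ξ in (Metric.closedBall 0 1)ᶜ, h ξ ∂μ =
      ∫ r in Set.Ioi (1 : ℝ), r ^ (Module.finrank ℝ X - 1) •
        ∫ η : Metric.sphere (0 : X) 1, h (r • (η : X)) ∂μ.toSphere := by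
  have hmeas : MeasurableSet (Metric.closedBall (0 : X) 1)ᶜ := measurableSet_closedBall.compl
  have hzero : (Metric.closedBall (0 : X) 1)ᶜ ⊆ {0}ᶜ := by simp
  have hpos : Set.Ioi (1 : ℝ) ⊆ Set.Ioi 0 := Set.Ioi_subset_Ioi zero_le_one
  have hindicator : ∀ r ∈ Set.Ioi (0 : ℝ), ∀ η : Metric.sphere (0 : X) 1,
      Set.indicator (Metric.closedBall 0 1)ᶜ h (r • (η : X)) =
        Set.indicator (Set.Ioi 1) (fun r => h (r • (η : X))) r := fun r hr η => by
    have hmem : r • (η : X) ∈ (Metric.closedBall (0 : X) 1)ᶜ ↔ r ∈ Set.Ioi 1 := by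
      simp [norm_smul, abs_of_pos hr.out]
    by_cases h1 : r ∈ Set.Ioi 1
    · rw [Set.indicator_of_mem (hmem.2 h1), Set.indicator_of_mem h1]
    · rw [Set.indicator_of_notMem (mt hmem.1 h1), Set.indicator_of_notMem h1]
  rw [← Set.inter_eq_right.2 hzero, ← setIntegral_indicator hmeas,
    setIntegral_compl_zero_eq_polar (hh.integrable_indicator hmeas),
    ← Set.inter_eq_right.2 hpos, ← setIntegral_indicator measurableSet_Ioi]
  refine setIntegral_congr_fun measurableSet_Ioi fun r hr => ?_
  simp only [hindicator r hr]
  by_cases h1 : r ∈ Set.Ioi 1 <;> simp only [Set.indicator_of_mem, Set.indicator_of_notMem, h1,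
    not_false_eq_true, integral_zero, smul_zero]

theorem setIntegral_compl_closedBall_eq_integral_exp {h : X → V}
    (hh : IntegrableOn h (Metric.closedBall 0 1)ᶜ μ) :
    ∫ ξ in (Metric.closedBall 0 1)ᶜ, h ξ ∂μ =
      ∫ t in Set.Ioi (0 : ℝ), Real.exp t ^ Module.finrank ℝ X •
        ∫ η : Metric.sphere (0 : X) 1, h (Real.exp t • (η : X)) ∂μ.toSphere := by
  have hexp := integral_comp_exp_Ioi (fun r => r ^ (Module.finrank ℝ X - 1) •
    ∫ η : Metric.sphere (0 : X) 1, h (r • (η : X)) ∂μ.toSphere) 0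
  rw [Real.exp_zero] at hexp
  rw [setIntegral_compl_closedBall_eq_polar hh, ← hexp]
  refine setIntegral_congr_fun measurableSet_Ioi fun t _ => ?_
  simp only [smul_smul]
  rcases Nat.eq_zero_or_pos (Module.finrank ℝ X) with hdim | hdim
  · simp [(μ.toSphere_eq_zero_iff_finrank).2 hdim]
  · rw [mul_pow_sub_one hdim.ne']

end PolarCoordinates

section UnitSphereMeasure

variable {n : ℕ}

/-- The surface measure of the unit sphere, as a measure on `ℝⁿ` carried by the sphere. -/
def unitSphereMeasure (n : ℕ) : Measure (E n) := (volume : Measure (E n)).toSphere.map Subtype.val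

theorem integral_unitSphereMeasure {V : Type*} [NormedAddCommGroup V] [NormedSpace ℝ V]
    (h : E n → V) : ∫ η, h η ∂unitSphereMeasure n =
      ∫ η : Metric.sphere (0 : E n) 1, h η ∂(volume : Measure (E n)).toSphere :=
  (MeasurableEmbedding.subtype_coe Metric.isClosed_sphere.measurableSet).integral_map h

instance : IsFiniteMeasure (unitSphereMeasure n) := by
  unfold unitSphereMeasure
  infer_instance

theorem ae_norm_eq_one_unitSphereMeasure : ∀ᵐ η ∂unitSphereMeasure n, ‖η‖ = 1 :=
  ((MeasurableEmbedding.subtype_coe Metric.isClosed_sphere.measurableSet).ae_map_iff).2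
    (Eventually.of_forall fun η => norm_eq_of_mem_sphere η)

theorem integrable_jb_rpow_unitSphereMeasure (s : ℝ) :
    Integrable (fun η => jb η ^ s) (unitSphereMeasure n) := by
  refine (integrable_const (Real.sqrt (1 + 1 ^ 2) ^ s)).congr ?_
  filter_upwards [ae_norm_eq_one_unitSphereMeasure] with η hη
  rw [jb, hη]

theorem setIntegral_compl_closedBall_eq_integral_unitSphereMeasure {V : Type*}
    [NormedAddCommGroup V] [NormedSpace ℝ V] {h : E n → V}
    (hh : IntegrableOn h (Metric.closedBall 0 1)ᶜ) :
    ∫ ξ in (Metric.closedBall 0 1)ᶜ, h ξ = ∫ t in Set.Ioi (0 : ℝ),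
      Real.exp t ^ n • ∫ η, h (Real.exp t • η) ∂unitSphereMeasure n := by
  simp only [setIntegral_compl_closedBall_eq_integral_exp hh, finrank_euclideanSpace_fin,
    integral_unitSphereMeasure fun η => h (_ • η)]

end UnitSphereMeasure

section Homogeneous

variable {n : ℕ} {V : Type*} [NormedAddCommGroup V] [NormedSpace ℂ V] {Γ : Sector} {q : ℝ}
  {F : E n → ℂ → V}

/-- Joint homogeneity of degree `q` in `(ξ, μ)`, for `|ξ| ≥ 1`. -/
def HomogeneousOutside (Γ : Sector) (q : ℝ) (F : E n → ℂ → V) : Prop :=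
  ∀ (ξ : E n) (μ : ℂ) (t : ℝ), 1 ≤ ‖ξ‖ → μ ∈ Γ.carrier → 1 ≤ t →
    F (t • ξ) (t * μ) = (t ^ q : ℝ) • F ξ μ

theorem HomogeneousOutside.exp_smul (hom : HomogeneousOutside Γ q F) {ξ : E n} (hξ : 1 ≤ ‖ξ‖)
    {w : ℂ} (hw : w.im ∈ Set.Ioo Γ.lo Γ.hi) {t : ℝ} (ht : 0 ≤ t) :
    F (Real.exp t • ξ) (Complex.exp w) = Real.exp (q * t) • F ξ (Complex.exp (w - t)) := by
  have hscale := hom ξ (Complex.exp (w - t)) (Real.exp t) hξ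
    (Sector.exp_mem_carrier (by simpa using hw)) (Real.one_le_exp ht)
  rwa [Complex.ofReal_exp, ← Complex.exp_add, add_sub_cancel, ← Real.exp_mul, mul_comm t] at hscale

/-- The integral of `F(·, μ)` over the unit sphere, as a function of `w = log μ`. -/
def sphereIntegral (F : E n → ℂ → V) (w : ℂ) : V := ∫ η, F η (Complex.exp w) ∂unitSphereMeasure n

/-- The radial density of `F` in logarithmic coordinates: the part of the integral of `F` outside
the unit ball is `e^{(q+n)w}` times a primitive of it. -/
def radialDensity (q : ℝ) (F : E n → ℂ → V) (w : ℂ) : V :=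
  Complex.exp ((-(q + n) : ℝ) * w) • sphereIntegral F w

theorem HomogeneousOutside.setIntegral_compl_closedBall (hom : HomogeneousOutside Γ q F)
    {w : ℂ} (hw : w.im ∈ Set.Ioo Γ.lo Γ.hi)
    (hint : Integrable fun ξ => F ξ (Complex.exp w)) :
    ∫ ξ in (Metric.closedBall 0 1)ᶜ, F ξ (Complex.exp w) =
      Complex.exp ((q + n : ℝ) * w) • horizontalIntegral (radialDensity q F) w := by
  rw [setIntegral_compl_closedBall_eq_integral_unitSphereMeasure hint.integrableOn,
    horizontalIntegral, ← integral_smul]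
  refine setIntegral_congr_fun measurableSet_Ioi fun t ht => ?_
  have hsphere : ∫ η, F (Real.exp t • η) (Complex.exp w) ∂unitSphereMeasure n =
      Real.exp (q * t) • sphereIntegral F (w - t) := by
    rw [sphereIntegral, ← integral_smul]
    exact integral_congr_ae (ae_norm_eq_one_unitSphereMeasure.mono fun η hη =>
      hom.exp_smul hη.ge hw (le_of_lt ht))
  simp only [hsphere, radialDensity]
  rw [smul_smul, smul_smul, ← Real.exp_nat_mul, ← Real.exp_add, ← Complex.exp_add,
    ← Complex.coe_smul, Complex.ofReal_exp]
  push_cast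
  ring_nf

variable {A : Type*} [CStarAlgebra A] {m d M d' : ℝ} {F : E n → ℂ → A}

/-- For `Re w ≤ X` homogeneity moves `w` to the right as far as `X`, which turns decay of `F` in
`ξ` into decay on the sphere as `Re w → -∞`. -/
theorem HomogeneousOutside.norm_le_of_re_le (hom : HomogeneousOutside Γ q F)
    (hF : IsParamSymbol Γ m d F) (hm : m ≤ 0) {a b : ℝ} (ha : Γ.lo < a) (hb : b < Γ.hi) (X : ℝ) :
    ∃ D : ℝ, ∀ w : ℂ, w.re ≤ X → w.im ∈ Set.Icc a b → ∀ ξ : E n, ‖ξ‖ = 1 →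
      ‖F ξ (Complex.exp w)‖ ≤ D * Real.exp ((q - m) * w.re) := by
  obtain ⟨C, hC⟩ := hF.norm_le ha hb
  obtain ⟨X', hX', hX0⟩ : ∃ X', X ≤ X' ∧ 0 ≤ X' := ⟨max X 0, le_max_left _ _, le_max_right _ _⟩
  refine ⟨|C| * Real.exp (d * X') * Real.exp ((m - q) * X'), fun w hw him ξ hξ => ?_⟩
  obtain ⟨t, ht⟩ : ∃ t : ℝ, t = X' - w.re := ⟨_, rfl⟩
  have ht0 : 0 ≤ t := by linarith
  have hre : (w + t).re = X' := by simp [ht]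
  have hmem : w + t ∈ halfStrip a b := ⟨hre ▸ hX0, by simpa using him⟩
  have hjb : jb (Real.exp t • ξ) ^ m ≤ Real.exp (m * t) := by
    rw [mul_comm, Real.exp_mul]
    refine Real.rpow_le_rpow_of_nonpos (Real.exp_pos _) ?_ hm
    simpa [norm_smul, hξ] using norm_le_jb (Real.exp t • ξ)
  have hscaled : Real.exp (q * t) * ‖F ξ (Complex.exp w)‖ ≤
      |C| * Real.exp (m * t) * Real.exp (d * X') := by
    have hbound := hC _ hmem (Real.exp t • ξ)
    rw [hom.exp_smul hξ.ge (im_mem_Ioo_of_mem_halfStrip ha hb hmem) ht0, norm_smul,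
      add_sub_cancel_right, hre, Real.norm_of_nonneg (Real.exp_pos _).le] at hbound
    refine hbound.trans ?_
    gcongr
    · exact Real.rpow_nonneg (jb_pos _).le _
    · exact le_abs_self C
  calc ‖F ξ (Complex.exp w)‖
      = Real.exp (-(q * t)) * (Real.exp (q * t) * ‖F ξ (Complex.exp w)‖) := by
        rw [← mul_assoc, ← Real.exp_add, neg_add_cancel, Real.exp_zero, one_mul]
    _ ≤ Real.exp (-(q * t)) * (|C| * Real.exp (m * t) * Real.exp (d * X')) := by gcongr
    _ = |C| * Real.exp (d * X') * (Real.exp (-(q * t)) * Real.exp (m * t)) := by ring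
    _ = |C| * Real.exp (d * X') * Real.exp ((m - q) * X') * Real.exp ((q - m) * w.re) := by
        rw [mul_assoc _ (Real.exp ((m - q) * X')), ← Real.exp_add, ← Real.exp_add, ht]
        ring_nf

theorem HomogeneousOutside.norm_sphereIntegral_le (hom : HomogeneousOutside Γ q F)
    (hF : IsParamSymbol Γ m d F) (hm : m ≤ 0) {a b : ℝ} (ha : Γ.lo < a) (hb : b < Γ.hi) (X : ℝ) :
    ∃ D : ℝ, ∀ w : ℂ, w.re ≤ X → w.im ∈ Set.Icc a b →
      ‖sphereIntegral F w‖ ≤ D * Real.exp ((q - m) * w.re) := by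
  obtain ⟨D, hD⟩ := hom.norm_le_of_re_le hF hm ha hb X
  refine ⟨D * (unitSphereMeasure n).real Set.univ, fun w hw him => ?_⟩
  rw [mul_right_comm]
  exact norm_integral_le_of_norm_le_const
    (ae_norm_eq_one_unitSphereMeasure.mono fun η hη => hD w hw him η hη)

theorem HomogeneousOutside.differentiableOn_sphereIntegral (hom : HomogeneousOutside Γ q F)
    (hF : IsParamSymbol Γ m d F) (hm : m ≤ 0) :
    DifferentiableOn ℂ (sphereIntegral F) (Complex.im ⁻¹' Set.Ioo Γ.lo Γ.hi) := by
  intro w₀ hw₀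
  obtain ⟨r, a, b, hr, ha, hb, hball⟩ := exists_ball_subset_strip hw₀
  obtain ⟨D, hD⟩ := hom.norm_le_of_re_le hF hm ha hb (w₀.re + r)
  have him : ∀ w ∈ Metric.ball w₀ r, w.im ∈ Set.Ioo Γ.lo Γ.hi := fun w hw =>
    ⟨ha.trans_le (hball w hw).2.1, (hball w hw).2.2.trans_lt hb⟩
  refine (hasDerivAt_integral_of_differentiableOn_ball
    (bound := fun _ => |D| * Real.exp (|q - m| * (|w₀.re| + r))) hr
    (fun w hw => (hF.continuous_exp (him w hw)).aestronglyMeasurable)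
    (Eventually.of_forall fun η => (hF.holomorphic η).comp
      Complex.differentiable_exp.differentiableOn fun w hw => Sector.exp_mem_carrier (him w hw))
    ?_ (integrable_const _)).2.differentiableAt.differentiableWithinAt
  filter_upwards [ae_norm_eq_one_unitSphereMeasure] with η hη w hw
  have hre : |w.re| ≤ |w₀.re| + r := by
    have hdist := (Complex.abs_re_le_norm (w - w₀)).trans (mem_ball_iff_norm.1 hw).le
    rw [Complex.sub_re] at hdist
    linarith [abs_sub_abs_le_abs_sub w.re w₀.re]
  have hexp : (q - m) * w.re ≤ |q - m| * (|w₀.re| + r) :=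
    (le_abs_self _).trans (by rw [abs_mul]; gcongr)
  refine (hD w (hball w hw).1 (hball w hw).2 η hη).trans ?_
  gcongr
  exact le_abs_self D

theorem HomogeneousOutside.hasDerivAt_horizontalIntegral_radialDensity
    (hom : HomogeneousOutside Γ q F) (hF : IsParamSymbol Γ m d F) (hm : m < -n) {w : ℂ}
    (hw : w.im ∈ Set.Ioo Γ.lo Γ.hi) :
    HasDerivAt (horizontalIntegral (radialDensity q F)) (radialDensity q F w) w := by
  have hm0 : m ≤ 0 := hm.le.trans (neg_nonpos.2 n.cast_nonneg)
  have hexp : Differentiable ℂ fun w => Complex.exp ((-(q + n) : ℝ) * w) := by fun_prop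
  have hdiff : DifferentiableOn ℂ (radialDensity q F) (Complex.im ⁻¹' Set.Ioo Γ.lo Γ.hi) :=
    hexp.differentiableOn.smul (hom.differentiableOn_sphereIntegral hF hm0)
  refine hasDerivAt_horizontalIntegral (ε := -n - m) (by linarith) hdiff
    (fun a b X ha hb => ?_) hw
  obtain ⟨D, hD⟩ := hom.norm_sphereIntegral_le hF hm0 ha hb X
  refine ⟨D, fun w hw him => ?_⟩
  rw [radialDensity, norm_smul, norm_exp_real_mul]
  refine (mul_le_mul_of_nonneg_left (hD w hw him) (Real.exp_pos _).le).trans_eq ?_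
  rw [mul_left_comm, ← Real.exp_add]
  ring_nf

theorem HomogeneousOutside.exists_integral_expansion (hom : HomogeneousOutside Γ q F)
    (hF : IsParamSymbol Γ M d F) (hF' : IsParamSymbol Γ m d' F) (hm : m < -n) :
    ∃ (c : A) (x y : ℕ → A), ∀ L : ℕ, LogBound Γ (d - L)
      ((fun w => ∫ ξ, F ξ (Complex.exp w)) - (fun w => Complex.exp ((q + n : ℝ) * w) • c) -
        logSum d x y L) := by
  obtain ⟨τ, hτ⟩ := hF.exists_hasTaylorExpansion
  obtain ⟨c, x, y, houter⟩ := exists_logBound_of_hasDerivAt (d := d)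
    (fun w _ hw => hom.hasDerivAt_horizontalIntegral_radialDensity hF' hm hw)
    fun K => hF.powBound_integral_sub_powSum hτ fun k _ => integrable_jb_rpow_unitSphereMeasure _
  have hball (s : ℝ) : IntegrableOn (fun ξ : E n => jb ξ ^ s) (Metric.closedBall 0 1) :=
    (continuous_jb_rpow s).continuousOn.integrableOn_compact (isCompact_closedBall 0 1)
  have hinner (L : ℕ) := (hF.powBound_integral_sub_powSum hτ (K := L) fun k _ => hball _).logBound
  simp only [← logSum_zero_left] at hinner
  refine ⟨c, 0 + x, (fun k => ∫ ξ in Metric.closedBall 0 1, τ k ξ) + y,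
    fun L => ((hinner L).add (houter L)).congr fun w hre hw => ?_⟩
  have hint := hF'.integrable (integrable_jb_rpow hm) hre hw
  simp only [logSum_add, Pi.add_apply, Pi.sub_apply]
  rw [← integral_add_compl measurableSet_closedBall hint,
    hom.setIntegral_compl_closedBall hw hint, smul_sub]
  abel

end Homogeneous

section TraceExpansion

variable {n : ℕ} {A : Type*} [CStarAlgebra A] {S : TwistedSystem n A} {Γ : Sector}

theorem IsParamSymbol.exists_integral_expansion_of_lt {M d : ℝ} {h : E n → ℂ → A}
    (hh : IsParamSymbol Γ M d h) {L : ℕ} (hL : M + L < -n) :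
    ∃ e : ℕ → A, LogBound Γ (d - L) ((fun w => ∫ ξ, h ξ (Complex.exp w)) - powSum d e L) := by
  obtain ⟨τ, hτ⟩ := hh.exists_hasTaylorExpansion
  refine ⟨_, (hh.powBound_integral_sub_powSum hτ fun k hk => integrable_jb_rpow ?_).logBound⟩
  exact (add_le_add_right (Nat.cast_le.2 hk) M).trans_lt hL

namespace IsWeaklyPolyhomogeneous

variable {m d m' d' : ℝ} {f : E n → ℂ → A} {F : ℕ → E n → ℂ → A}

theorem exists_isParamSymbol_term (hf : IsWeaklyPolyhomogeneous S Γ m d f F) (hm' : m' < -n)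
    (hF' : ∀ j : ℕ, -(n : ℝ) ≤ m - j - d → IsWeakSymbol S Γ m' d' (F j)) (j : ℕ) :
    ∃ m₀ d₀ : ℝ, m₀ < -n ∧ IsParamSymbol Γ m₀ d₀ (F j) := by
  rcases le_or_gt (-(n : ℝ)) (m - j - d) with hj | hj
  · exact ⟨m', d', hm', (hF' j hj).isParamSymbol⟩
  · exact ⟨m - j - d, d, hj, (hf.term_mem j).isParamSymbol⟩

theorem exists_integral_term_expansion (hf : IsWeaklyPolyhomogeneous S Γ m d f F) (hm' : m' < -n)
    (hF' : ∀ j : ℕ, -(n : ℝ) ≤ m - j - d → IsWeakSymbol S Γ m' d' (F j)) (j : ℕ) :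
    ∃ (c : A) (x y : ℕ → A), ∀ L : ℕ, LogBound Γ (d - L)
      ((fun w => ∫ ξ, F j ξ (Complex.exp w)) - (fun w => Complex.exp ((m + n - j : ℝ) * w) • c) -
        logSum d x y L) := by
  obtain ⟨m₀, d₀, hm₀, hF₀⟩ := hf.exists_isParamSymbol_term hm' hF' j
  have hom : HomogeneousOutside Γ (m - j) (F j) := hf.homogeneous j
  simpa only [sub_add_eq_add_sub] using
    hom.exists_integral_expansion (hf.term_mem j).isParamSymbol hF₀ hm₀

theorem exists_integral_expansion_of_lt (hf : IsWeaklyPolyhomogeneous S Γ m d f F)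
    (hm' : m' < -n) (hf' : IsWeakSymbol S Γ m' d' f)
    (hF' : ∀ j : ℕ, -(n : ℝ) ≤ m - j - d → IsWeakSymbol S Γ m' d' (F j)) {c : ℕ → A}
    {x y : ℕ → ℕ → A} {L N : ℕ} (hN : m - d - N + L < -n)
    (hterm : ∀ j, LogBound Γ (d - L) ((fun w => ∫ ξ, F j ξ (Complex.exp w)) -
      (fun w => Complex.exp ((m + n - j : ℝ) * w) • c j) - logSum d (x j) (y j) L)) :
    ∃ x y : ℕ → A, LogBound Γ (d - L)
      ((fun w => ∫ ξ, f ξ (Complex.exp w)) - powSum (m + n) c N - logSum d x y L) := by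
  obtain ⟨e, hremainder⟩ := (hf.remainder N).isParamSymbol.exists_integral_expansion_of_lt hN
  rw [← logSum_zero_left] at hremainder
  refine ⟨∑ j ∈ Finset.range N, x j + 0, ∑ j ∈ Finset.range N, y j + e,
    ((LogBound.sum (t := Finset.range N) fun j _ => hterm j).add hremainder).congr
      fun w hre hw => ?_⟩
  have hint_f := hf'.isParamSymbol.integrable (integrable_jb_rpow hm') hre hw
  have hint : ∀ j ∈ Finset.range N, Integrable fun ξ => F j ξ (Complex.exp w) := fun j _ => by
    obtain ⟨m₀, d₀, hm₀, hF₀⟩ := hf.exists_isParamSymbol_term hm' hF' j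
    exact hF₀.integrable (integrable_jb_rpow hm₀) hre hw
  simp only [logSum_add, logSum_sum, Pi.add_apply, Pi.sub_apply, Finset.sum_apply,
    Finset.sum_sub_distrib, powSum]
  rw [integral_sub hint_f (integrable_finsetSum _ hint), integral_finsetSum _ hint]
  abel

theorem exists_integral_expansion (hf : IsWeaklyPolyhomogeneous S Γ m d f F) (hm' : m' < -n)
    (hf' : IsWeakSymbol S Γ m' d' f)
    (hF' : ∀ j : ℕ, -(n : ℝ) ≤ m - j - d → IsWeakSymbol S Γ m' d' (F j)) :
    ∃ (N : ℕ → ℕ) (c x y : ℕ → A), (∀ L, L ≤ N L) ∧ ∀ L : ℕ, LogBound Γ (d - L)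
      ((fun w => ∫ ξ, f ξ (Complex.exp w)) - powSum (m + n) c (N L) - logSum d x y L) := by
  choose c x y hterm using hf.exists_integral_term_expansion hm' hF'
  obtain ⟨N₀, hN₀⟩ := exists_nat_gt (m + n - d)
  obtain ⟨x, y, hxy⟩ := exists_coefficients (p := m + n) (c := c) (N := fun L => L + N₀)
    (fun L L' hL => Nat.add_le_add_right hL N₀) (fun L => by push_cast; linarith) fun L =>
    hf.exists_integral_expansion_of_lt hm' hf' hF' (by push_cast; linarith) fun j => hterm j L
  exact ⟨_, c, x, y, fun L => Nat.le_add_right L N₀, hxy⟩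

end IsWeaklyPolyhomogeneous

theorem IsWeakSymbol.isSymbol {m d : ℝ} {f : E n → ℂ → A} (hf : IsWeakSymbol S Γ m d f) {μ : ℂ}
    (hμ : μ ∈ Γ.carrier) : S.IsSymbol m fun ξ => f ξ μ := by
  have hpow : Γ.pow μ (-d) ≠ 0 := Complex.exp_ne_zero _
  have hsymbol := (hf.symbol 0 μ⁻¹ (by rwa [inv_inv])).const_smul (Γ.pow μ (-d))⁻¹
  simpa only [zDeriv, iteratedDeriv_zero, inv_inv, Nat.cast_zero, add_zero, smul_smul,
    inv_mul_cancel₀ hpow, one_smul] using hsymbol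

theorem powSum_eq_sum_mul_pow {p : ℝ} (c : ℕ → ℂ) (J : ℕ) {w : ℂ}
    (hw : w.im ∈ Set.Ioo Γ.lo Γ.hi) :
    powSum p c J w = ∑ j ∈ Finset.range J, c j * Γ.pow (Complex.exp w) (p - j) := by
  simp only [powSum, Sector.pow_exp hw, smul_eq_mul, mul_comm]

theorem logSum_eq_sum_mul_pow {d : ℝ} (x y : ℕ → ℂ) (K : ℕ) {w : ℂ}
    (hw : w.im ∈ Set.Ioo Γ.lo Γ.hi) :
    logSum d x y K w = ∑ k ∈ Finset.range K,
      (x k * Γ.log (Complex.exp w) + y k) * Γ.pow (Complex.exp w) (d - k) := by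
  simp only [logSum, Sector.pow_exp hw, Sector.log_exp hw, smul_eq_mul, mul_comm]

theorem hasLogExpansion_of_logBound {p d : ℝ} {G : ℂ → ℂ} {c x y : ℕ → ℂ} {N : ℕ → ℕ}
    (hN : ∀ L, L ≤ N L) (h : ∀ L : ℕ, LogBound Γ (d - L)
      ((fun w => G (Complex.exp w)) - powSum p c (N L) - logSum d x y L)) :
    HasLogExpansion Γ p d G c x y := by
  intro a b ha hb J K
  have hJ : J ≤ N (max J K) := (le_max_left J K).trans (hN _)
  obtain ⟨C, hC⟩ := logBound_sub_logSum_of_le (le_max_right J K) (h (max J K)) a b ha hb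
  refine ⟨|C| + ∑ j ∈ Finset.Ico J (N (max J K)), ‖c j‖, fun μ hμ hone => ?_⟩
  obtain ⟨w, hw, rfl⟩ := Sector.exists_exp_of_mem_closedSector hμ hone
  have hre := hw.1
  have him := im_mem_Ioo_of_mem_halfStrip ha hb hw
  have hnorm : ∀ t : ℝ, ‖Complex.exp w‖ ^ t = Real.exp (t * w.re) := fun t => by
    rw [Complex.norm_exp, ← Real.exp_mul, mul_comm]
  rw [hnorm, hnorm, Complex.norm_exp, Real.log_exp, ← powSum_eq_sum_mul_pow c J him,
    ← logSum_eq_sum_mul_pow x y K him]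
  have hpowSum := norm_powSum_sub_powSum_le (d := p) c hJ hre
  calc ‖G (Complex.exp w) - powSum p c J w - logSum d x y K w‖
      = ‖(G (Complex.exp w) - powSum p c (N (max J K)) w - logSum d x y K w) +
          (powSum p c (N (max J K)) w - powSum p c J w)‖ := by congr 1; ring
    _ ≤ |C| * ((1 + w.re) * Real.exp ((d - K) * w.re)) +
          (∑ j ∈ Finset.Ico J (N (max J K)), ‖c j‖) * Real.exp ((p - J) * w.re) :=
        norm_add_le_of_le ((hC w hw).trans (by gcongr; exact le_abs_self C)) hpowSum
    _ ≤ (|C| + ∑ j ∈ Finset.Ico J (N (max J K)), ‖c j‖) *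
          (Real.exp ((p - J) * w.re) + (1 + w.re) * Real.exp ((d - K) * w.re)) := by
        rw [add_mul |C|]
        gcongr
        · exact le_add_of_nonneg_left (Real.exp_pos _).le
        · exact le_add_of_nonneg_right (by positivity)

end TraceExpansion

end WeaklyParametric

end

theorem mainTheorem2_general {n : ℕ} {A : Type*} [CStarAlgebra A]
    (S : WeaklyParametric.TwistedSystem n A) (ψ : A →L[ℂ] ℂ)
    (Γ : WeaklyParametric.Sector) (m d : ℝ)
    (f : WeaklyParametric.E n → ℂ → A) (F : ℕ → WeaklyParametric.E n → ℂ → A)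
    (hf : WeaklyParametric.IsWeaklyPolyhomogeneous S Γ m d f F)
    (m' d' : ℝ) (hm' : m' < -(n : ℝ))
    (hf' : WeaklyParametric.IsWeakSymbol S Γ m' d' f)
    (hF' : ∀ j : ℕ, -(n : ℝ) ≤ m - j - d → WeaklyParametric.IsWeakSymbol S Γ m' d' (F j)) :
    (∀ μ ∈ Γ.carrier,
      S.HasTraceSymbol (S.multiplier fun ξ => f ξ μ) (fun ξ => f ξ μ) ∧
      MeasureTheory.Integrable (fun ξ => ψ (f ξ μ)) ∧
      S.Tr ψ (S.multiplier fun ξ => f ξ μ) =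
        (((2 * Real.pi : ℝ) ^ n)⁻¹ : ℝ) * ∫ ξ, ψ (f ξ μ)) ∧
    ∃ c c' c'' : ℕ → ℂ,
      WeaklyParametric.HasLogExpansion Γ (m + n) d
        (fun μ => S.Tr ψ (S.multiplier fun ξ => f ξ μ)) c c' c'' := by
  have hsym : ∀ μ ∈ Γ.carrier,
      S.HasTraceSymbol (S.multiplier fun ξ => f ξ μ) (fun ξ => f ξ μ) := fun μ hμ =>
    ⟨⟨m', hm', hf'.isSymbol hμ⟩, rfl⟩
  have hint : ∀ μ ∈ Γ.carrier, MeasureTheory.Integrable fun ξ => f ξ μ := fun μ hμ =>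
    (hf'.isSymbol hμ).integrable hm'
  refine ⟨fun μ hμ => ⟨hsym μ hμ, ψ.integrable_comp (hint μ hμ), ?_⟩, ?_⟩
  · rw [(hsym μ hμ).tr_eq ψ, ψ.integral_comp_comm (hint μ hμ)]
  · obtain ⟨N, c, x, y, hN, h⟩ := hf.exists_integral_expansion hm' hf' hF'
    let φ : A →L[ℂ] ℂ := ((((2 * Real.pi : ℝ) ^ n)⁻¹ : ℝ) : ℂ) • ψ
    refine ⟨φ ∘ c, φ ∘ x, φ ∘ y, WeaklyParametric.hasLogExpansion_of_logBound hN fun L =>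
      ((h L).continuousLinearMap_comp φ).congr fun w _ hw => ?_⟩
    simp only [Function.comp_apply, Pi.sub_apply, map_sub, WeaklyParametric.map_powSum,
      WeaklyParametric.map_logSum]
    rw [(hsym _ (WeaklyParametric.Sector.exp_mem_carrier hw)).tr_eq ψ]
    rfl

theorem mainTheorem2 {n : ℕ} {A : Type*} [CStarAlgebra A]
    (S : WeaklyParametric.TwistedSystem n A)
    (ψ : A →L[ℂ] ℂ) (hψ : WeaklyParametric.IsInvariantTrace S ψ)
    (Γ : WeaklyParametric.Sector) (m d : ℝ)
    (f : WeaklyParametric.E n → ℂ → A) (F : ℕ → WeaklyParametric.E n → ℂ → A)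
    (hf : WeaklyParametric.IsWeaklyPolyhomogeneous S Γ m d f F)
    (m' d' : ℝ) (hm' : m' < -(n : ℝ))
    (hf' : WeaklyParametric.IsWeakSymbol S Γ m' d' f)
    (hF' : ∀ j : ℕ, -(n : ℝ) ≤ m - j - d → WeaklyParametric.IsWeakSymbol S Γ m' d' (F j)) :
    (∀ μ ∈ Γ.carrier,
      S.HasTraceSymbol (S.multiplier fun ξ => f ξ μ) (fun ξ => f ξ μ) ∧
      MeasureTheory.Integrable (fun ξ => ψ (f ξ μ)) ∧
      S.Tr ψ (S.multiplier fun ξ => f ξ μ) =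
        (((2 * Real.pi : ℝ) ^ n)⁻¹ : ℝ) * ∫ ξ, ψ (f ξ μ)) ∧
    ∃ c c' c'' : ℕ → ℂ,
      WeaklyParametric.HasLogExpansion Γ (m + n) d
        (fun μ => S.Tr ψ (S.multiplier fun ξ => f ξ μ)) c c' c'' :=
  mainTheorem2_general S ψ Γ m d f F hf m' d' hm' hf' hF'
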